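/- For a $4\times4$ matrix $A$ and $S\subseteq N=\{1,2,3,4\}$ let $A[S]$ be the principal submatrix of $A$ on the rows and columns in $S$, with $\det A[\emptyset]=1$. For index sets $\alpha_1,\dots,\alpha_p\subseteq N$ with positive real exponents $\eta_1,\dots,\eta_p$ put $\alpha(A)=\prod_{i}(\det A[\alpha_i])^{\eta_i}$, also written $\alpha_1^{\eta_1}\cdots\alpha_p^{\eta_p}$ with exponents $1$ omitted. A ratio $\alpha/\beta$ of two such products is bounded if there is a constant $C$ with $\alpha(A)/\beta(A)\le C$ for all positive definite $A$; $\mathcal B_4$ is the multiplicative semigroup of bounded ratios. The formal logarithm $\log(\alpha/\beta)\in\mathbb R^{2^N}$ has as its entry at each nonempty $S\subseteq N$ the overall exponent (numerator minus denominator) of $S$, and its entry at $\emptyset$ is chosen so that the sum of all entries is $0$; ratios with the same formal logarithm are identified. Permutations of $N$ and the complementation $S\mapsto N\setminus S$ act on ratios through their natural actions on $\mathbb R^{2^N}$. Let $$R_1=\frac{\{124\}\{134\}\{23\}\{1\}\{4\}}{\{12\}\{13\}\{14\}\{24\}\{34\}},\quad R_2=\frac{\{1234\}\{1234\}\{23\}\{24\}\{34\}\{1\}\,\emptyset}{\{123\}\{124\}\{134\}\{234\}\{2\}\{3\}\{4\}},\quad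 R_3=\frac{\{1234\}\{23\}\{24\}\{34\}\{1\}\{1\}\,\emptyset}{\{234\}\{12\}\{13\}\{14\}\{2\}\{3\}\{4\}}.$$ Theorem. Let positive definite matrices be either real symmetric or complex Hermitian. (1) $\mathcal B_4$ is generated, up to permutation and complementation, by positive powers of $\frac{\{12\}\,\emptyset}{\{1\}\{2\}}$, $\frac{\{123\}\{1\}}{\{12\}\{13\}}$, $R_1$, $R_2$ and $R_3$; that is, a ratio is bounded if and only if it is a finite (possibly empty) product of positive real powers of ratios obtained from these five by permutations of the indices and complementation. (2) The cone $\log(\mathcal B_4)$ has exactly $46$ extreme rays. They are the $24$ rays spanned by the formal logarithms of the Koteljanskii ratios $\frac{(S\cup T)\,(S\cap T)}{S\;T}$ with $|S|=|T|=|S\cap T|+1$, the $6$ rays spanned by the formal logarithms of the permutations of $R_1$, and the $16$ rays spanned by the formal logarithms of the permutations of $R_2$ and $R_3$ and of their complements. -/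

import Mathlib

open scoped ComplexOrder

namespace PDRatio

/-- A collection `α : α₁, …, α_p` of index sets, each with a positive real exponent.
Index sets are subsets of `Fin n`; the label `i ∈ {1, …, n}` is `i - 1 : Fin n`. -/
abbrev Collection (n : ℕ) := List (Finset (Fin n) × {η : ℝ // 0 < η})

/-- The principal minor `det A[S]` (a real number when `A` is Hermitian); it is `1` for `S = ∅`. -/
noncomputable def minor {𝕜 : Type*} [RCLike 𝕜] {n : ℕ}
    (A : Matrix (Fin n) (Fin n) 𝕜) (S : Finset (Fin n)) : ℝ :=
  RCLike.re
    (A.submatrix (fun i : {i // i ∈ S} => (i : Fin n)) (fun i : {i // i ∈ S} => (i : Fin n))).det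

/-- `α(A) = ∏ i, (det A[α i]) ^ (η i)`. -/
noncomputable def Collection.eval {𝕜 : Type*} [RCLike 𝕜] {n : ℕ} (α : Collection n)
    (A : Matrix (Fin n) (Fin n) 𝕜) : ℝ :=
  (α.map fun p => minor A p.1 ^ (p.2 : ℝ)).prod

/-- The total exponent of the index set `S` in `α`. -/
noncomputable def Collection.exponent {n : ℕ} (α : Collection n) (S : Finset (Fin n)) : ℝ :=
  (α.map fun p => if p.1 = S then (p.2 : ℝ) else 0).sum

/-- The collection of the listed index sets, each with exponent `1`. -/
def Collection.ofSets {n : ℕ} (l : List (Finset (Fin n))) : Collection n :=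
  l.map fun S => (S, ⟨1, one_pos⟩)

/-- A formal ratio `α / β` of products of powers of principal minors. -/
@[ext]
structure Ratio (n : ℕ) where
  num : Collection n
  den : Collection n

namespace Ratio

/-- Multiplication of ratios: numerators and denominators are juxtaposed. -/
instance instMonoid (n : ℕ) : Monoid (Ratio n) where
  mul r s := ⟨r.num ++ s.num, r.den ++ s.den⟩
  one := ⟨[], []⟩
  mul_assoc r s t := Ratio.ext (List.append_assoc _ _ _) (List.append_assoc _ _ _)
  one_mul _ := rfl
  mul_one r := Ratio.ext (List.append_nil _) (List.append_nil _)

/-- The positive real power `(α / β) ^ t`: all exponents are multiplied by `t`. -/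
noncomputable def rpow {n : ℕ} (r : Ratio n) (t : {t : ℝ // 0 < t}) : Ratio n :=
  ⟨r.num.map fun p => (p.1, t * p.2), r.den.map fun p => (p.1, t * p.2)⟩

/-- The ratio of `∏ S ∈ l, S` and `∏ S ∈ m, S`, with all exponents `1`. -/
def ofSets {n : ℕ} (l m : List (Finset (Fin n))) : Ratio n :=
  ⟨Collection.ofSets l, Collection.ofSets m⟩

/-- The value `α(A) / β(A)`. -/
noncomputable def eval {𝕜 : Type*} [RCLike 𝕜] {n : ℕ} (r : Ratio n)
    (A : Matrix (Fin n) (Fin n) 𝕜) : ℝ :=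
  r.num.eval A / r.den.eval A

/-- The formal logarithm: the overall exponent (numerator minus denominator) of each nonempty
set, and for `∅` the number that makes the sum of all `2 ^ n` entries `0`. -/
noncomputable def log {n : ℕ} (r : Ratio n) : Finset (Fin n) → ℝ := fun S =>
  if S = ∅ then
    - ∑ T ∈ Finset.univ.erase (∅ : Finset (Fin n)), (r.num.exponent T - r.den.exponent T)
  else r.num.exponent S - r.den.exponent S

/-- Two ratios are equivalent if they have the same formal logarithm. -/
def Equivalent {n : ℕ} (r s : Ratio n) : Prop := r.log = s.log

/-- `α(A) / β(A)` has an upper bound that is independent of the positive definite matrix `A`. -/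
def IsBounded (𝕜 : Type*) [RCLike 𝕜] {n : ℕ} (r : Ratio n) : Prop :=
  ∃ C : ℝ, ∀ A : Matrix (Fin n) (Fin n) 𝕜, A.PosDef → r.eval A ≤ C

end Ratio

theorem minor_pos {𝕜 : Type*} [RCLike 𝕜] {n : ℕ} {A : Matrix (Fin n) (Fin n) 𝕜}
    (hA : A.PosDef) (S : Finset (Fin n)) : 0 < minor A S :=
  (RCLike.pos_iff.mp (hA.submatrix Subtype.val_injective).det_pos).1

theorem Collection.eval_pos {𝕜 : Type*} [RCLike 𝕜] {n : ℕ} (α : Collection n)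
    {A : Matrix (Fin n) (Fin n) 𝕜} (hA : A.PosDef) : 0 < α.eval A := by
  unfold Collection.eval
  refine List.prod_pos ?_
  intro a ha
  obtain ⟨p, -, rfl⟩ := List.mem_map.mp ha
  exact Real.rpow_pos_of_pos (minor_pos hA _) _

theorem Ratio.eval_pos {𝕜 : Type*} [RCLike 𝕜] {n : ℕ} (r : Ratio n)
    {A : Matrix (Fin n) (Fin n) 𝕜} (hA : A.PosDef) : 0 < r.eval A :=
  div_pos (r.num.eval_pos hA) (r.den.eval_pos hA)

theorem Ratio.eval_mul {𝕜 : Type*} [RCLike 𝕜] {n : ℕ} (r s : Ratio n)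
    (A : Matrix (Fin n) (Fin n) 𝕜) : (r * s).eval A = r.eval A * s.eval A := by
  change Collection.eval (r.num ++ s.num) A / Collection.eval (r.den ++ s.den) A = _
  simp only [Ratio.eval, Collection.eval, List.map_append, List.prod_append]
  rw [mul_div_mul_comm]

/-- `𝓑 n`, the multiplicative semigroup (with unit) of bounded ratios. -/
def boundedRatios (𝕜 : Type*) [RCLike 𝕜] (n : ℕ) : Submonoid (Ratio n) where
  carrier := {r | r.IsBounded 𝕜}
  one_mem' := by
    refine ⟨1, fun A _ => ?_⟩
    change Collection.eval [] A / Collection.eval [] A ≤ 1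
    simp [Collection.eval]
  mul_mem' := by
    rintro r s ⟨C, hC⟩ ⟨D, hD⟩
    refine ⟨C * D, fun A hA => ?_⟩
    rw [Ratio.eval_mul]
    exact mul_le_mul (hC A hA) (hD A hA) (s.eval_pos hA).le
      ((r.eval_pos hA).le.trans (hC A hA))

/-- `log (𝓑 n)`, the cone of formal logarithms of bounded ratios. -/
def logBoundedRatios (𝕜 : Type*) [RCLike 𝕜] (n : ℕ) : Set (Finset (Fin n) → ℝ) :=
  Ratio.log '' (boundedRatios 𝕜 n : Set (Ratio n))

/-- The natural action of a permutation of the indices on `ℝ ^ (2 ^ N)`: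
the entry of `x` at `S` becomes the entry at `σ(S)`. -/
def permute {n : ℕ} (σ : Equiv.Perm (Fin n)) (x : Finset (Fin n) → ℝ) : Finset (Fin n) → ℝ :=
  fun S => x (S.map σ.symm.toEmbedding)

/-- The natural action of set complementation on `ℝ ^ (2 ^ N)`. -/
def complement {n : ℕ} (x : Finset (Fin n) → ℝ) : Finset (Fin n) → ℝ := fun S => x Sᶜ

/-- The formal logarithms of all permutations of `r`. -/
def permutations {n : ℕ} (r : Ratio n) : Set (Finset (Fin n) → ℝ) :=
  Set.range fun σ : Equiv.Perm (Fin n) => permute σ r.log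

/-- The formal logarithms of all permutations of `r` and of their complements. -/
def orbit {n : ℕ} (r : Ratio n) : Set (Finset (Fin n) → ℝ) :=
  permutations r ∪ complement '' permutations r

/-- A ratio lies in the semigroup generated, up to permutation and complementation, by positive
powers of members of `G` if it is equivalent to a finite product of positive real powers of ratios
whose formal logarithms arise from those of members of `G` by permutation and complementation. -/
def generatedUpToSymmetry {n : ℕ} (G : Set (Ratio n)) : Set (Ratio n) :=
  {r | ∃ s ∈ Submonoid.closure
      {q : Ratio n | ∃ g ∈ G, ∃ h : Ratio n, h.log ∈ orbit g ∧ ∃ t, q = h.rpow t},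
    r.Equivalent s}

/-- The Koteljanskii ratio `(S ∪ T) (S ∩ T) / (S T)`. -/
def koteljanskii {n : ℕ} (S T : Finset (Fin n)) : Ratio n :=
  Ratio.ofSets [S ∪ T, S ∩ T] [S, T]

/-- The formal logarithms of the Koteljanskii ratios with `|S| = |T| = |S ∩ T| + 1`. -/
def basicKoteljanskii (n : ℕ) : Set (Finset (Fin n) → ℝ) :=
  {x | ∃ S T : Finset (Fin n), S.card = T.card ∧ T.card = (S ∩ T).card + 1 ∧
    x = (koteljanskii S T).log}

/-- `{12} ∅ / {1} {2}`. -/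
def K₁ : Ratio 4 := Ratio.ofSets [{0, 1}, ∅] [{0}, {1}]

/-- `{123} {1} / {12} {13}`. -/
def K₂ : Ratio 4 := Ratio.ofSets [{0, 1, 2}, {0}] [{0, 1}, {0, 2}]

/-- `{124} {134} {23} {1} {4} / {12} {13} {14} {24} {34}`. -/
def R₁ : Ratio 4 :=
  Ratio.ofSets [{0, 1, 3}, {0, 2, 3}, {1, 2}, {0}, {3}] [{0, 1}, {0, 2}, {0, 3}, {1, 3}, {2, 3}]

/-- `{1234} {1234} {23} {24} {34} {1} ∅ / {123} {124} {134} {234} {2} {3} {4}`. -/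
def R₂ : Ratio 4 :=
  Ratio.ofSets [{0, 1, 2, 3}, {0, 1, 2, 3}, {1, 2}, {1, 3}, {2, 3}, {0}, ∅]
    [{0, 1, 2}, {0, 1, 3}, {0, 2, 3}, {1, 2, 3}, {1}, {2}, {3}]

/-- `{1234} {23} {24} {34} {1} {1} ∅ / {234} {12} {13} {14} {2} {3} {4}`. -/
def R₃ : Ratio 4 :=
  Ratio.ofSets [{0, 1, 2, 3}, {1, 2}, {1, 3}, {2, 3}, {0}, {0}, ∅]
    [{1, 2, 3}, {0, 1}, {0, 2}, {0, 3}, {1}, {2}, {3}]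

/-- The ray `{t v : t ≥ 0}` spanned by `v`. -/
def ray {E : Type*} [AddCommGroup E] [Module ℝ E] (v : E) : Set E := {w | ∃ t : ℝ, 0 ≤ t ∧ w = t • v}

/-- The extreme rays of a cone `K`: the rays spanned by nonzero vectors that are extreme
subsets (faces) of `K`. -/
def extremeRays {E : Type*} [AddCommGroup E] [Module ℝ E] (K : Set E) : Set (Set E) :=
  {ρ | (∃ v, v ≠ 0 ∧ ρ = ray v) ∧ IsExtreme ℝ K ρ}

end PDRatio

/-! Taking logarithms turns a ratio into a linear form `x` on the vectors `(log det A[S])`, and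
boundedness into an upper bound for that form. The bounded forms with entry sum `0` make up a convex
cone, which is squeezed between two polyhedral cones.

Inner cone. The 46 vectors of `genRows` are bounded. Besides the Koteljanskii inequalities this
rests on `minor_triangle`, a triangle inequality for angles between lines. On the logarithmic scale
it says, up to a constant, that each of the three quantities `l {i,j} + l {k}` is at most the larger
of the other two (`QuasiTropical`). Passing to `A⁻¹` and applying Jacobi's identity gives the same
inequalities for complements, and `R₁`, `R₂`, `R₃` follow by adding inequalities in each branch of
the resulting case distinctions.

Outer cone. Along a family of positive definite matrices with `det A(t)[S]` of exact order `t ^ y S`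
as `t → 0⁺`, a bounded form must satisfy `∑ x S * y S ≥ 0`. Diagonal scalings give linear equations.
Families in which rows become parallel, their inverses, and families degenerating to Gram matrices
of plane vectors give the 23 inequalities of `facetRows`.

The cones agree. By `exists_support_pos`, each nonzero `x` in the outer cone has a generator `v`
such that every facet form that is positive on `v` is positive on `x`. Subtracting the largest
admissible multiple of `v` makes another facet form vanish, and induction writes `x` as a
nonnegative combination of generators. The sets of facet forms that are nonzero on the respective
generators form an antichain, so each generator spans an extreme ray and there are exactly 46 of
them. All the families used are real, while the upper bounds hold over `ℂ`, so the cone does not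
depend on the field. -/

namespace PDRatio

/-- The linear form `x` is bounded above on the vectors of logarithms of principal minors of
positive definite matrices. -/
def BoundedForm (𝕜 : Type*) [RCLike 𝕜] {n : ℕ} (x : Finset (Fin n) → ℝ) : Prop :=
  ∃ C : ℝ, ∀ A : Matrix (Fin n) (Fin n) 𝕜, A.PosDef →
    ∑ S, x S * Real.log (minor A S) ≤ C

/-! ### Ratios as linear forms in the logarithms of principal minors. -/

section FormalLog

variable {𝕜 : Type*} [RCLike 𝕜] {n : ℕ}

theorem minor_empty (A : Matrix (Fin n) (Fin n) 𝕜) : minor A ∅ = 1 := by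
  simp [minor]

theorem Collection.exponent_cons (p : Finset (Fin n) × {η : ℝ // 0 < η}) (α : Collection n)
    (S : Finset (Fin n)) :
    Collection.exponent (p :: α) S = (if p.1 = S then (p.2 : ℝ) else 0) + Collection.exponent α S := by
  simp [Collection.exponent]

theorem Collection.exponent_append (α β : Collection n) (S : Finset (Fin n)) :
    Collection.exponent (α ++ β) S = Collection.exponent α S + Collection.exponent β S := by
  simp [Collection.exponent]

theorem Collection.log_eval (α : Collection n) {A : Matrix (Fin n) (Fin n) 𝕜} (hA : A.PosDef) :
    Real.log (Collection.eval α A) = ∑ S, Collection.exponent α S * Real.log (minor A S) := by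
  induction α with
  | nil => simp [Collection.eval, Collection.exponent]
  | cons p α ih =>
    have h : Collection.eval (p :: α) A = minor A p.1 ^ (p.2 : ℝ) * Collection.eval α A := by
      simp [Collection.eval]
    rw [h, Real.log_mul (Real.rpow_pos_of_pos (minor_pos hA _) _).ne' (Collection.eval_pos α hA).ne',
      Real.log_rpow (minor_pos hA _), ih]
    simp [Collection.exponent_cons, add_mul, Finset.sum_add_distrib, ite_mul]

/-- The normalising entry of `r.log` at `∅` is harmless because it multiplies `log 1 = 0`. -/
theorem Ratio.log_eval (r : Ratio n) {A : Matrix (Fin n) (Fin n) 𝕜} (hA : A.PosDef) :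
    Real.log (r.eval A) = ∑ S, r.log S * Real.log (minor A S) := by
  rw [Ratio.eval, Real.log_div (r.num.eval_pos hA).ne' (r.den.eval_pos hA).ne',
    Collection.log_eval _ hA, Collection.log_eval _ hA, ← Finset.sum_sub_distrib]
  refine Finset.sum_congr rfl fun S _ => ?_
  by_cases hS : S = ∅
  · subst hS; simp [minor_empty]
  · simp [Ratio.log, hS, sub_mul]

theorem Ratio.isBounded_iff (r : Ratio n) : r.IsBounded 𝕜 ↔ BoundedForm 𝕜 r.log := by
  constructor
  · rintro ⟨C, hC⟩
    refine ⟨Real.log C, fun A hA => ?_⟩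
    rw [← r.log_eval hA]
    exact Real.log_le_log (r.eval_pos hA) (hC A hA)
  · rintro ⟨C, hC⟩
    refine ⟨Real.exp C, fun A hA => ?_⟩
    rw [← Real.log_le_iff_le_exp (r.eval_pos hA), r.log_eval hA]
    exact hC A hA

theorem Ratio.sum_log (r : Ratio n) : ∑ S, r.log S = 0 := by
  rw [← Finset.add_sum_erase _ _ (Finset.mem_univ ∅)]
  rw [Finset.sum_congr rfl fun S hS => show r.log S = r.num.exponent S - r.den.exponent S by
    simp [Ratio.log, Finset.ne_of_mem_erase hS]]
  simp [Ratio.log]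

theorem Ratio.log_ext {r : Ratio n} {x : Finset (Fin n) → ℝ} (hx : ∑ S, x S = 0)
    (h : ∀ S, S ≠ ∅ → r.num.exponent S - r.den.exponent S = x S) : r.log = x := by
  have h' : ∀ S, S ≠ ∅ → r.log S = x S := fun S hS => by simp [Ratio.log, hS, h S hS]
  funext S
  by_cases hS : S = ∅
  · subst hS
    have h1 := r.sum_log
    rw [← Finset.add_sum_erase _ _ (Finset.mem_univ ∅)] at h1 hx
    rw [Finset.sum_congr rfl fun S hS => h' S (Finset.ne_of_mem_erase hS)] at h1
    linarith
  · exact h' S hS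

theorem Ratio.log_one : (1 : Ratio n).log = 0 := by
  refine Ratio.log_ext (by simp) fun S _ => ?_
  change Collection.exponent [] S - Collection.exponent [] S = 0
  simp

theorem Ratio.log_mul (r s : Ratio n) : (r * s).log = r.log + s.log := by
  refine Ratio.log_ext (by simp [Finset.sum_add_distrib, Ratio.sum_log]) fun S hS => ?_
  change Collection.exponent (r.num ++ s.num) S - Collection.exponent (r.den ++ s.den) S = _
  simp only [Collection.exponent_append, Pi.add_apply, Ratio.log, hS, if_false]
  ring

theorem Collection.exponent_map_smul (α : Collection n) (t : {t : ℝ // 0 < t})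
    (S : Finset (Fin n)) :
    Collection.exponent (α.map fun p => (p.1, t * p.2)) S = t * Collection.exponent α S := by
  induction α with
  | nil => simp [Collection.exponent]
  | cons p α ih =>
    rw [List.map_cons, Collection.exponent_cons, ih, Collection.exponent_cons, mul_add]
    simp

theorem Ratio.log_rpow (r : Ratio n) (t : {t : ℝ // 0 < t}) :
    (r.rpow t).log = (t : ℝ) • r.log := by
  refine Ratio.log_ext (by simp [← Finset.mul_sum, Ratio.sum_log]) fun S hS => ?_
  simp only [Ratio.rpow, Collection.exponent_map_smul, Pi.smul_apply, Ratio.log, hS, if_false,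
    smul_eq_mul]
  ring

theorem Collection.exists_exponent_eq (x : Finset (Fin n) → ℝ) (hx : ∀ S, 0 ≤ x S) :
    ∃ α : Collection n, ∀ S, Collection.exponent α S = x S := by
  suffices h : ∀ s : Finset (Finset (Fin n)), ∃ α : Collection n,
      ∀ S, Collection.exponent α S = if S ∈ s then x S else 0 by
    obtain ⟨α, hα⟩ := h Finset.univ
    exact ⟨α, by simpa using hα⟩
  intro s
  induction s using Finset.induction_on with
  | empty => exact ⟨[], by simp [Collection.exponent]⟩
  | insert T s hT ih =>
    obtain ⟨α, hα⟩ := ih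
    -- Exponents in a collection are strictly positive, so a set with `x T = 0` has to be left out.
    rcases (hx T).eq_or_lt with h0 | h0
    · refine ⟨α, fun S => ?_⟩
      by_cases hST : S = T
      · subst hST; simp [hα, hT, ← h0]
      · simp [hα, hST]
    · refine ⟨(T, ⟨x T, h0⟩) :: α, fun S => ?_⟩
      rw [Collection.exponent_cons, hα]
      by_cases hST : S = T
      · subst hST; simp [hT]
      · simp [hST, Ne.symm hST]

theorem Ratio.exists_log_eq {x : Finset (Fin n) → ℝ} (hx : ∑ S, x S = 0) :
    ∃ r : Ratio n, r.log = x := by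
  obtain ⟨α, hα⟩ := Collection.exists_exponent_eq (fun S => max (x S) 0) fun S => le_max_right _ _
  obtain ⟨β, hβ⟩ := Collection.exists_exponent_eq (fun S => max (-x S) 0) fun S => le_max_right _ _
  refine ⟨⟨α, β⟩, Ratio.log_ext hx fun S _ => ?_⟩
  rw [hα, hβ]
  exact max_zero_sub_max_neg_zero_eq_self (x S)

theorem logBoundedRatios_eq :
    logBoundedRatios 𝕜 n = {x | ∑ S, x S = 0 ∧ BoundedForm 𝕜 x} := by
  ext x
  constructor
  · rintro ⟨r, hr, rfl⟩
    exact ⟨r.sum_log, r.isBounded_iff.mp hr⟩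
  · rintro ⟨h0, hx⟩
    obtain ⟨r, rfl⟩ := Ratio.exists_log_eq h0
    exact ⟨r, r.isBounded_iff.mpr hx, rfl⟩

theorem BoundedForm.zero : BoundedForm 𝕜 (0 : Finset (Fin n) → ℝ) :=
  ⟨0, fun A _ => by simp⟩

theorem BoundedForm.add {x y : Finset (Fin n) → ℝ} (hx : BoundedForm 𝕜 x)
    (hy : BoundedForm 𝕜 y) : BoundedForm 𝕜 (x + y) := by
  obtain ⟨C, hC⟩ := hx
  obtain ⟨D, hD⟩ := hy
  refine ⟨C + D, fun A hA => ?_⟩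
  simp only [Pi.add_apply, add_mul, Finset.sum_add_distrib]
  exact add_le_add (hC A hA) (hD A hA)

theorem BoundedForm.smul {x : Finset (Fin n) → ℝ} (hx : BoundedForm 𝕜 x) {t : ℝ} (ht : 0 ≤ t) :
    BoundedForm 𝕜 (t • x) := by
  obtain ⟨C, hC⟩ := hx
  refine ⟨t * C, fun A hA => ?_⟩
  simp only [Pi.smul_apply, smul_eq_mul, mul_assoc, ← Finset.mul_sum]
  exact mul_le_mul_of_nonneg_left (hC A hA) ht

end FormalLog

/-! ### Symmetries of principal minors, Jacobi's identity, minors of size at most three. -/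

section Minors

variable {𝕜 : Type*} [RCLike 𝕜] {n : ℕ}

theorem minor_eq_re_det {ι : Type*} [Fintype ι] [DecidableEq ι] (A : Matrix (Fin n) (Fin n) 𝕜)
    (f : ι → Fin n) (hf : Function.Injective f) {S : Finset (Fin n)}
    (hS : Finset.univ.image f = S) : minor A S = RCLike.re (A.submatrix f f).det := by
  subst hS
  let e : ι ≃ {i // i ∈ Finset.univ.image f} :=
    Equiv.ofBijective (fun i => ⟨f i, Finset.mem_image_of_mem f (Finset.mem_univ i)⟩)
      ⟨fun i j h => hf (congrArg Subtype.val h), fun ⟨i, hi⟩ => by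
        obtain ⟨j, -, rfl⟩ := Finset.mem_image.mp hi
        exact ⟨j, rfl⟩⟩
  rw [minor, ← Matrix.det_submatrix_equiv_self e]
  rfl

theorem coe_minor {A : Matrix (Fin n) (Fin n) 𝕜} (hA : A.PosDef) (S : Finset (Fin n)) :
    (minor A S : 𝕜) = (A.submatrix (fun i : {i // i ∈ S} => (i : Fin n))
      (fun i : {i // i ∈ S} => (i : Fin n))).det := by
  have h := (RCLike.pos_iff.mp (hA.submatrix (Subtype.val_injective (p := (· ∈ S)))).det_pos).2
  refine RCLike.ext ?_ ?_
  · rw [RCLike.ofReal_re, minor]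
  · rw [RCLike.ofReal_im, h]

theorem minor_submatrix_perm (A : Matrix (Fin n) (Fin n) 𝕜) (σ : Equiv.Perm (Fin n))
    (S : Finset (Fin n)) : minor (A.submatrix σ σ) S = minor A (S.map σ.toEmbedding) := by
  rw [minor, minor_eq_re_det A (fun i : {i // i ∈ S} => σ i)
    (σ.injective.comp Subtype.val_injective)]
  · rfl
  · ext i
    simp [Finset.mem_map_equiv, ← Equiv.eq_symm_apply]

/-- Jacobi's identity for complementary principal minors. -/
theorem minor_inv {A : Matrix (Fin n) (Fin n) 𝕜} (hA : A.PosDef) (S : Finset (Fin n)) :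
    minor A⁻¹ Sᶜ * minor A Finset.univ = minor A S := by
  let e := Equiv.sumCompl (· ∈ S)
  let X := A⁻¹.submatrix e e
  let B := A.submatrix e e
  have hBX : B * X = 1 := by
    rw [Matrix.submatrix_mul_equiv,
      Matrix.mul_nonsing_inv _ ((Matrix.isUnit_iff_isUnit_det _).mp hA.isUnit),
      Matrix.submatrix_one_equiv]
  have hdet : B.det * X.toBlocks₂₂.det = B.toBlocks₁₁.det := by
    -- With `X = B⁻¹` in block form, the second block column of `B * X = 1` gives this product. Its
    -- factors are block triangular, so determinants give the identity.
    have h : B * Matrix.fromBlocks 1 X.toBlocks₁₂ 0 X.toBlocks₂₂ =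
        Matrix.fromBlocks B.toBlocks₁₁ 0 B.toBlocks₂₁ 1 := by
      have h1 := hBX
      rw [← Matrix.fromBlocks_toBlocks X, ← Matrix.fromBlocks_toBlocks B,
        Matrix.fromBlocks_multiply, ← Matrix.fromBlocks_one, Matrix.fromBlocks_inj] at h1
      conv_lhs => rw [← Matrix.fromBlocks_toBlocks B]
      rw [Matrix.fromBlocks_multiply, Matrix.fromBlocks_inj]
      exact ⟨by simp, h1.2.1, by simp, h1.2.2.2⟩
    have h2 := congrArg Matrix.det h
    rwa [Matrix.det_mul, Matrix.det_fromBlocks_zero₂₁, Matrix.det_fromBlocks_zero₁₂,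
      Matrix.det_one, Matrix.det_one, one_mul, mul_one] at h2
  have h1 : X.toBlocks₂₂.det = (minor A⁻¹ Sᶜ : 𝕜) := by
    rw [coe_minor hA.inv, ← Matrix.det_submatrix_equiv_self
      (Equiv.subtypeEquivRight fun i => (Finset.mem_compl (s := S) (a := i)).symm)]
    rfl
  have h2 : B.det = (minor A Finset.univ : 𝕜) := by
    rw [coe_minor hA, Matrix.det_submatrix_equiv_self, ← Matrix.det_submatrix_equiv_self
      (Equiv.subtypeUnivEquiv fun i => Finset.mem_univ i)]
    rfl
  have h3 : B.toBlocks₁₁.det = (minor A S : 𝕜) := (coe_minor hA S).symm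
  rw [h1, h2, h3, mul_comm] at hdet
  exact_mod_cast hdet

theorem BoundedForm.permute {x : Finset (Fin n) → ℝ} (hx : BoundedForm 𝕜 x)
    (σ : Equiv.Perm (Fin n)) : BoundedForm 𝕜 (permute σ x) := by
  obtain ⟨C, hC⟩ := hx
  refine ⟨C, fun A hA => ?_⟩
  refine le_of_eq_of_le ?_ (hC (A.submatrix σ σ) (hA.submatrix σ.injective))
  refine (Fintype.sum_equiv (Equiv.finsetCongr σ) _ _ fun S => ?_).symm
  have h : (S.map σ.toEmbedding).map σ.symm.toEmbedding = S := by ext; simp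
  change x S * _ = x ((S.map σ.toEmbedding).map σ.symm.toEmbedding) *
    Real.log (minor A (S.map σ.toEmbedding))
  rw [minor_submatrix_perm, h]

/-- Jacobi's identity replaces `A` by `A⁻¹` at the cost of adding `log det A` to every entry. A form
with entry sum `0` does not see this shift. -/
theorem BoundedForm.complement {x : Finset (Fin n) → ℝ} (hx : BoundedForm 𝕜 x)
    (h0 : ∑ S, x S = 0) : BoundedForm 𝕜 (complement x) := by
  obtain ⟨C, hC⟩ := hx
  refine ⟨C, fun A hA => ?_⟩
  refine le_of_eq_of_le ?_ (hC A⁻¹ hA.inv)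
  have h : ∀ S, Real.log (minor A S) =
      Real.log (minor A⁻¹ Sᶜ) + Real.log (minor A Finset.univ) := fun S => by
    rw [← Real.log_mul (minor_pos hA.inv _).ne' (minor_pos hA _).ne', minor_inv hA]
  rw [Finset.sum_congr rfl fun S _ => congrArg (PDRatio.complement x S * ·) (h S)]
  simp only [PDRatio.complement, mul_add, Finset.sum_add_distrib, ← Finset.sum_mul]
  have hc : ∀ f : Finset (Fin n) → ℝ, ∑ S, f Sᶜ = ∑ S, f S := fun f =>
    Fintype.sum_equiv ⟨compl, compl, compl_compl, compl_compl⟩ _ _ fun S => rfl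
  rw [hc x, h0, zero_mul, add_zero, hc fun S => x S * Real.log (minor A⁻¹ S)]

theorem coe_re_diag {A : Matrix (Fin n) (Fin n) 𝕜} (hA : A.PosDef) (i : Fin n) :
    A i i = (RCLike.re (A i i) : 𝕜) :=
  (RCLike.conj_eq_iff_re.mp (hA.isHermitian.apply i i)).symm

theorem minor_singleton (A : Matrix (Fin n) (Fin n) 𝕜) (i : Fin n) :
    minor A {i} = RCLike.re (A i i) := by
  rw [minor_eq_re_det A ![i] (by intro a b _; exact Subsingleton.elim a b) (by simp), Matrix.det_fin_one]
  rfl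

theorem minor_pair {A : Matrix (Fin n) (Fin n) 𝕜} (hA : A.PosDef) {i j : Fin n} (hij : i ≠ j) :
    minor A {i, j} = RCLike.re (A i i) * RCLike.re (A j j) - ‖A i j‖ ^ 2 := by
  rw [minor_eq_re_det A ![i, j] (by simp [Function.Injective, Fin.forall_fin_two, hij, hij.symm])
    (by ext; simp [Fin.exists_fin_two, eq_comm]), Matrix.det_fin_two]
  simp only [Matrix.submatrix_apply, Matrix.cons_val_zero, Matrix.cons_val_one]
  rw [← hA.isHermitian.apply j i, coe_re_diag hA i, coe_re_diag hA j]
  have h := RCLike.mul_conj (A i j)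
  rw [← RCLike.star_def] at h
  rw [h, ← RCLike.ofReal_mul, ← RCLike.ofReal_pow, ← RCLike.ofReal_sub, RCLike.ofReal_re,
    RCLike.ofReal_re, RCLike.ofReal_re]

theorem minor_triple {A : Matrix (Fin n) (Fin n) 𝕜} (hA : A.PosDef) {i j k : Fin n} (hij : i ≠ j)
    (hik : i ≠ k) (hjk : j ≠ k) :
    minor A {i, j, k} = RCLike.re (A i i) * RCLike.re (A j j) * RCLike.re (A k k)
      + 2 * RCLike.re (A i j * A j k * A k i) - RCLike.re (A i i) * ‖A j k‖ ^ 2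
      - RCLike.re (A j j) * ‖A k i‖ ^ 2 - RCLike.re (A k k) * ‖A i j‖ ^ 2 := by
  rw [minor_eq_re_det A ![i, j, k]
    (by simp [Function.Injective, Fin.forall_fin_succ, hij, hij.symm, hik, hik.symm, hjk, hjk.symm])
    (by ext; simp [Fin.exists_fin_succ, eq_comm]), Matrix.det_fin_three]
  simp only [Matrix.submatrix_apply, Matrix.cons_val_zero, Matrix.cons_val_one, Matrix.cons_val]
  -- The two cyclic products in the expansion are complex conjugates, whence the term `2 * re (x * y
  -- * z)`.
  have h : ∀ (a b c : ℝ) (x y z : 𝕜), RCLike.re ((a : 𝕜) * b * c - a * y * star y - x * star x * c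
      + x * y * z + star z * star x * star y - star z * b * z) =
      a * b * c + 2 * RCLike.re (x * y * z) - a * ‖y‖ ^ 2 - b * ‖z‖ ^ 2 - c * ‖x‖ ^ 2 := by
    intro a b c x y z
    have e1 : (a : 𝕜) * b * c - a * y * star y - x * star x * c + x * y * z
        + star z * star x * star y - star z * b * z = ((a * b * c - a * ‖y‖ ^ 2 - c * ‖x‖ ^ 2
        - b * ‖z‖ ^ 2 : ℝ) : 𝕜) + (x * y * z + star (x * y * z)) := by
      have hx := RCLike.mul_conj x
      have hy := RCLike.mul_conj y
      have hz := RCLike.mul_conj z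
      simp only [← RCLike.star_def] at hx hy hz
      push_cast
      rw [star_mul, star_mul, ← hx, ← hy, ← hz]
      ring
    rw [e1, map_add, map_add, RCLike.ofReal_re, RCLike.star_def, RCLike.conj_re]
    ring
  rw [← hA.isHermitian.apply j i, ← hA.isHermitian.apply k j, ← hA.isHermitian.apply i k,
    coe_re_diag hA i, coe_re_diag hA j, coe_re_diag hA k, h]
  simp

end Minors

/-! ### Hadamard, Koteljanskii and angle inequalities. -/

section UpperBounds

variable {𝕜 : Type*} [RCLike 𝕜] {n : ℕ}

theorem minor_pair_le {A : Matrix (Fin n) (Fin n) 𝕜} (hA : A.PosDef) {i j : Fin n} (hij : i ≠ j) :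
    minor A {i, j} ≤ minor A {i} * minor A {j} := by
  rw [minor_pair hA hij, minor_singleton, minor_singleton]
  linarith [sq_nonneg ‖A i j‖]

theorem norm_apply_comm {A : Matrix (Fin n) (Fin n) 𝕜} (hA : A.PosDef) (i j : Fin n) :
    ‖A i j‖ = ‖A j i‖ := by
  rw [← hA.isHermitian.apply i j, norm_star]

theorem re_mul_mul_le (x y z : 𝕜) : RCLike.re (x * y * z) ≤ ‖x‖ * ‖y‖ * ‖z‖ := by
  rw [← norm_mul, ← norm_mul]
  exact RCLike.re_le_norm _

/-- The difference of the two sides is `|A i i * A j k - A j i * A i k| ^ 2`. The square of the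
difference of the norms of these two products is already a sufficient lower bound. -/
theorem minor_triple_mul_le {A : Matrix (Fin n) (Fin n) 𝕜} (hA : A.PosDef) {i j k : Fin n}
    (hij : i ≠ j) (hik : i ≠ k) (hjk : j ≠ k) :
    minor A {i, j, k} * minor A {i} ≤ minor A {i, j} * minor A {i, k} := by
  have ha := minor_pos hA {i}
  rw [minor_triple hA hij hik hjk, minor_pair hA hij, minor_pair hA hik, minor_singleton,
    norm_apply_comm hA i k]
  rw [minor_singleton] at ha
  have h := re_mul_mul_le (A i j) (A j k) (A k i)
  nlinarith [sq_nonneg (RCLike.re (A i i) * ‖A j k‖ - ‖A i j‖ * ‖A k i‖),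
    mul_le_mul_of_nonneg_left h ha.le]

/-- The inequality behind the triangle inequality for angles between lines. -/
theorem gram_triangle {a b c x y z : ℝ} (ha : 0 < a) (hb : 0 < b) (hc : 0 < c) (hx : 0 ≤ x)
    (hxy : x ^ 2 < a * b)
    (hdet : a * z ^ 2 + b * y ^ 2 + c * x ^ 2 ≤ a * b * c + 2 * (x * y * z)) :
    (a * b - x ^ 2) * c ≤ 2 * ((a * c - y ^ 2) * b + (b * c - z ^ 2) * a) := by
  obtain ⟨p, hp, rfl⟩ : ∃ p, 0 < p ∧ p ^ 2 = a := ⟨√a, Real.sqrt_pos.mpr ha, Real.sq_sqrt ha.le⟩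
  obtain ⟨q, hq, rfl⟩ : ∃ q, 0 < q ∧ q ^ 2 = b := ⟨√b, Real.sqrt_pos.mpr hb, Real.sq_sqrt hb.le⟩
  have hlt : x < p * q := lt_of_pow_lt_pow_left₀ 2 (by positivity) (by linarith [mul_pow p q 2])
  -- By `hdet` and `2 * p * q * y * z ≤ (p * z) ^ 2 + (q * y) ^ 2`, the inequality holds after
  -- multiplication by `p * q - x > 0`.
  have h1 : 2 * (y * z) ≤ c * (p * q + x) := by
    refine le_of_mul_le_mul_left ?_ (sub_pos.mpr hlt)
    nlinarith [sq_nonneg (p * z - q * y)]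
  -- Bounding `y ^ 2` and `z ^ 2` by `hdet` and then `x * y * z` by `h1` leaves exactly `c * (p * q
  -- - x) ^ 2 ≥ 0`.
  nlinarith [mul_le_mul_of_nonneg_left h1 hx, mul_nonneg hc.le (sq_nonneg (p * q - x))]

/-- Divided by the three diagonal entries, this compares squared sines of angles between lines:
`sin² θ_ij ≤ 2 (sin² θ_ik + sin² θ_jk)`. Complex phases only decrease the determinant of size three,
so the entries may be replaced by their norms. -/
theorem minor_triangle {A : Matrix (Fin n) (Fin n) 𝕜} (hA : A.PosDef) {i j k : Fin n}
    (hij : i ≠ j) (hik : i ≠ k) (hjk : j ≠ k) :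
    minor A {i, j} * minor A {k} ≤
      2 * (minor A {i, k} * minor A {j} + minor A {j, k} * minor A {i}) := by
  have ha := minor_pos hA {i}
  have hb := minor_pos hA {j}
  have hc := minor_pos hA {k}
  have hp := minor_pos hA {i, j}
  have hd := minor_pos hA {i, j, k}
  have h := re_mul_mul_le (A i j) (A j k) (A k i)
  rw [minor_triple hA hij hik hjk] at hd
  rw [minor_pair hA hij] at hp
  rw [minor_pair hA hij, minor_pair hA hik, minor_pair hA hjk, minor_singleton, minor_singleton,
    minor_singleton, norm_apply_comm hA i k]
  rw [minor_singleton] at ha hb hc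
  refine gram_triangle ha hb hc (norm_nonneg _) (by linarith) ?_
  linarith

end UpperBounds

/-! ### Quasi-tropical inequalities and the bounds for `R₁`, `R₂`, `R₃`. -/

/-- The inequalities between logarithms of principal minors of size at most three from which
all bounded ratios are obtained. -/
structure QuasiTropical {n : ℕ} (c : ℝ) (l : Finset (Fin n) → ℝ) : Prop where
  nonneg : 0 ≤ c
  pair : ∀ {i j}, i ≠ j → l {i, j} + l ∅ ≤ l {i} + l {j}
  triple : ∀ {i j k}, i ≠ j → i ≠ k → j ≠ k → l {i, j, k} + l {i} ≤ l {i, j} + l {i, k}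
  triangle : ∀ {i j k}, i ≠ j → i ≠ k → j ≠ k →
    l {i, j} + l {k} ≤ c + l {i, k} + l {j} ∨ l {i, j} + l {k} ≤ c + l {j, k} + l {i}

theorem quasiTropical_log_minor {𝕜 : Type*} [RCLike 𝕜] {n : ℕ} {A : Matrix (Fin n) (Fin n) 𝕜}
    (hA : A.PosDef) : QuasiTropical (Real.log 4) fun S => Real.log (minor A S) where
  nonneg := Real.log_nonneg (by norm_num)
  pair {i j} hij := by
    have h := Real.log_le_log (minor_pos hA _) (minor_pair_le hA hij)
    rw [Real.log_mul (minor_pos hA _).ne' (minor_pos hA _).ne'] at h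
    simpa [minor_empty] using h
  triple {i j k} hij hik hjk := by
    have h := Real.log_le_log (mul_pos (minor_pos hA _) (minor_pos hA _))
      (minor_triple_mul_le hA hij hik hjk)
    rwa [Real.log_mul (minor_pos hA _).ne' (minor_pos hA _).ne',
      Real.log_mul (minor_pos hA _).ne' (minor_pos hA _).ne'] at h
  triangle {i j k} hij hik hjk := by
    have h := minor_triangle hA hij hik hjk
    have hlog : ∀ S T U V, minor A S * minor A T ≤ 4 * (minor A U * minor A V) →
        Real.log (minor A S) + Real.log (minor A T) ≤
          Real.log 4 + Real.log (minor A U) + Real.log (minor A V) := fun S T U V h => by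
      have h1 := Real.log_le_log (mul_pos (minor_pos hA _) (minor_pos hA _)) h
      rw [Real.log_mul (minor_pos hA _).ne' (minor_pos hA _).ne', Real.log_mul (by norm_num)
        (mul_pos (minor_pos hA _) (minor_pos hA _)).ne',
        Real.log_mul (minor_pos hA _).ne' (minor_pos hA _).ne'] at h1
      linarith
    -- A sum is at most twice its larger term; with the factor `2` of `minor_triangle` this gives
    -- `4`.
    rcases le_total (minor A {i, k} * minor A {j}) (minor A {j, k} * minor A {i}) with h1 | h1
    · exact Or.inr (hlog _ _ _ _ (by linarith))
    · exact Or.inl (hlog _ _ _ _ (by linarith))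

/-- Both sides of each inequality have two terms in `l`. This is why `pair` keeps `l ∅`: it vanishes
for minors, but not after complementation, where the shift by `log det A` enters. -/
theorem QuasiTropical.add_const {n : ℕ} {c : ℝ} {l : Finset (Fin n) → ℝ} (h : QuasiTropical c l)
    (d : ℝ) : QuasiTropical c fun S => l S + d where
  nonneg := h.nonneg
  pair hij := by linarith [h.pair hij]
  triple hij hik hjk := by linarith [h.triple hij hik hjk]
  triangle hij hik hjk := by
    rcases h.triangle hij hik hjk with h | h
    · left; linarith
    · right; linarith

theorem quasiTropical_log_minor_compl {𝕜 : Type*} [RCLike 𝕜] {n : ℕ}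
    {A : Matrix (Fin n) (Fin n) 𝕜} (hA : A.PosDef) :
    QuasiTropical (Real.log 4) fun S => Real.log (minor A Sᶜ) := by
  have h : (fun S => Real.log (minor A Sᶜ)) =
      fun S => Real.log (minor A⁻¹ S) + Real.log (minor A Finset.univ) := by
    funext S
    rw [← Real.log_mul (minor_pos hA.inv _).ne' (minor_pos hA _).ne', ← minor_inv hA Sᶜ,
      compl_compl]
  rw [h]
  exact (quasiTropical_log_minor hA.inv).add_const _

theorem Ratio.log_eval_ofSets {𝕜 : Type*} [RCLike 𝕜] {n : ℕ} (s t : List (Finset (Fin n)))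
    {A : Matrix (Fin n) (Fin n) 𝕜} (hA : A.PosDef) :
    Real.log ((Ratio.ofSets s t).eval A) =
      (s.map fun S => Real.log (minor A S)).sum - (t.map fun S => Real.log (minor A S)).sum := by
  have h : ∀ s : List (Finset (Fin n)), Real.log ((Collection.ofSets s).eval A) =
      (s.map fun S => Real.log (minor A S)).sum := fun s => by
    induction s with
    | nil => simp [Collection.ofSets, Collection.eval]
    | cons S s ih =>
      have h1 : (Collection.ofSets (S :: s)).eval A =
          minor A S * (Collection.ofSets s).eval A := by
        simp [Collection.eval, Collection.ofSets]
      rw [h1, Real.log_mul (minor_pos hA _).ne' (Collection.eval_pos _ hA).ne', ih]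
      simp
  rw [Ratio.eval, Real.log_div (Collection.eval_pos _ hA).ne' (Collection.eval_pos _ hA).ne']
  exact congrArg₂ _ (h s) (h t)

/-- In each branch it suffices to add `t1`, one of `t3` and `t4` (`t4` if `t1` holds in its first
form, `t3` otherwise), and two of the `triple` inequalities. The two triangle inequalities account
for `2 * c`. -/
theorem QuasiTropical.log_R₁_le {c : ℝ} {l : Finset (Fin 4) → ℝ} (h : QuasiTropical c l) :
    l {0, 1, 3} + l {0, 2, 3} + l {1, 2} + l {0} + l {3} ≤
      l {0, 1} + l {0, 2} + l {0, 3} + l {1, 3} + l {2, 3} + 2 * c := by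
  have e10 : ({1, 0} : Finset (Fin 4)) = {0, 1} := by decide
  have e20 : ({2, 0} : Finset (Fin 4)) = {0, 2} := by decide
  have e30 : ({3, 0} : Finset (Fin 4)) = {0, 3} := by decide
  have e31 : ({3, 1} : Finset (Fin 4)) = {1, 3} := by decide
  have e32 : ({3, 2} : Finset (Fin 4)) = {2, 3} := by decide
  have e1 : ({1, 0, 3} : Finset (Fin 4)) = {0, 1, 3} := by decide
  have e2 : ({2, 0, 3} : Finset (Fin 4)) = {0, 2, 3} := by decide
  have e3 : ({3, 0, 1} : Finset (Fin 4)) = {0, 1, 3} := by decide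
  have e4 : ({3, 0, 2} : Finset (Fin 4)) = {0, 2, 3} := by decide
  have k1 := h.triple (i := 0) (j := 1) (k := 3) (by decide) (by decide) (by decide)
  have k2 := h.triple (i := 0) (j := 2) (k := 3) (by decide) (by decide) (by decide)
  have k3 := h.triple (i := 1) (j := 0) (k := 3) (by decide) (by decide) (by decide)
  have k4 := h.triple (i := 2) (j := 0) (k := 3) (by decide) (by decide) (by decide)
  have k5 := h.triple (i := 3) (j := 0) (k := 1) (by decide) (by decide) (by decide)
  have k6 := h.triple (i := 3) (j := 0) (k := 2) (by decide) (by decide) (by decide)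
  have t1 := h.triangle (i := 1) (j := 2) (k := 3) (by decide) (by decide) (by decide)
  have t2 := h.triangle (i := 1) (j := 2) (k := 0) (by decide) (by decide) (by decide)
  have t3 := h.triangle (i := 0) (j := 3) (k := 1) (by decide) (by decide) (by decide)
  have t4 := h.triangle (i := 0) (j := 3) (k := 2) (by decide) (by decide) (by decide)
  simp only [e10, e20, e30, e31, e32, e1, e2, e3, e4] at *
  rcases t1 with t1 | t1 <;> rcases t2 with t2 | t2 <;> rcases t3 with t3 | t3 <;>
    rcases t4 with t4 | t4 <;> linarith

/-- The three triangle inequalities are added. If each pair `{0, a}` occurs once on the right, what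
remains is `l {0,1,2,3} + l ∅ ≤ l {1,2,3} + l {0}`. Otherwise some `{0, a}` occurs twice and some
`{0, b}` not at all, and what remains is the sum of `l {0,1,2,3} + l {b} ≤ l {1,2,3} + l {0,b}` and
`l {0,a} + l ∅ ≤ l {0} + l {a}`. All of these are sums of the inequalities `p`, `q`, `r`. -/
theorem QuasiTropical.log_R₃_le {c : ℝ} {l m : Finset (Fin 4) → ℝ} (h : QuasiTropical c l)
    (h' : QuasiTropical c m) (hm : ∀ S, m S = l Sᶜ) :
    l {0, 1, 2, 3} + l {1, 2} + l {1, 3} + l {2, 3} + l {0} + l {0} + l ∅ ≤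
      l {1, 2, 3} + l {0, 1} + l {0, 2} + l {0, 3} + l {1} + l {2} + l {3} + 3 * c := by
  have e1 : ({1, 0} : Finset (Fin 4)) = {0, 1} := by decide
  have e2 : ({2, 0} : Finset (Fin 4)) = {0, 2} := by decide
  have e3 : ({3, 0} : Finset (Fin 4)) = {0, 3} := by decide
  have d0 : (∅ : Finset (Fin 4))ᶜ = {0, 1, 2, 3} := by decide
  have d1 : ({0} : Finset (Fin 4))ᶜ = {1, 2, 3} := by decide
  have d2 : ({1, 2} : Finset (Fin 4))ᶜ = {0, 3} := by decide
  have d3 : ({1, 3} : Finset (Fin 4))ᶜ = {0, 2} := by decide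
  have d4 : ({2, 3} : Finset (Fin 4))ᶜ = {0, 1} := by decide
  have d5 : ({0, 1, 2} : Finset (Fin 4))ᶜ = {3} := by decide
  have d8 : ({1} : Finset (Fin 4))ᶜ = {0, 2, 3} := by decide
  have d9 : ({2} : Finset (Fin 4))ᶜ = {0, 1, 3} := by decide
  have d10 : ({3} : Finset (Fin 4))ᶜ = {0, 1, 2} := by decide
  have d11 : ({0, 1} : Finset (Fin 4))ᶜ = {2, 3} := by decide
  have d12 : ({0, 2} : Finset (Fin 4))ᶜ = {1, 3} := by decide
  have d13 : ({0, 3} : Finset (Fin 4))ᶜ = {1, 2} := by decide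
  have d6 : ({0, 1, 3} : Finset (Fin 4))ᶜ = {2} := by decide
  have d7 : ({0, 2, 3} : Finset (Fin 4))ᶜ = {1} := by decide
  have s1 : ({1, 0, 2} : Finset (Fin 4)) = {0, 1, 2} := by decide
  have s2 : ({1, 0, 3} : Finset (Fin 4)) = {0, 1, 3} := by decide
  have s3 : ({2, 0, 3} : Finset (Fin 4)) = {0, 2, 3} := by decide
  have t1 := h.triangle (i := 1) (j := 2) (k := 0) (by decide) (by decide) (by decide)
  have t2 := h.triangle (i := 1) (j := 3) (k := 0) (by decide) (by decide) (by decide)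
  have t3 := h.triangle (i := 2) (j := 3) (k := 0) (by decide) (by decide) (by decide)
  have p1 := h.pair (i := 0) (j := 1) (by decide)
  have p2 := h.pair (i := 0) (j := 2) (by decide)
  have p3 := h.pair (i := 0) (j := 3) (by decide)
  have q1 := h'.pair (i := 0) (j := 1) (by decide)
  have q2 := h'.pair (i := 0) (j := 2) (by decide)
  have q3 := h'.pair (i := 0) (j := 3) (by decide)
  have r1 := h'.triple (i := 1) (j := 0) (k := 2) (by decide) (by decide) (by decide)
  have r2 := h'.triple (i := 1) (j := 0) (k := 3) (by decide) (by decide) (by decide)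
  have r3 := h'.triple (i := 2) (j := 0) (k := 3) (by decide) (by decide) (by decide)
  have hc := h.nonneg
  simp only [e1, e2, e3, s1, s2, s3, hm, d0, d1, d2, d3, d4, d5, d6, d7, d8, d9, d10, d11, d12, d13] at *
  rcases t1 with t1 | t1 <;> rcases t2 with t2 | t2 <;> rcases t3 with t3 | t3 <;> linarith

/-- One triangle inequality for `l` brings in a pair `{0, a}`, which one triangle inequality for the
complements removes again; one `pair` inequality for `l` and two for the complements finish. Two
triangle inequalities therefore suffice in each branch, and the rest of `5 * c` is slack covered by
`hc`. -/
theorem QuasiTropical.log_R₂_le {c : ℝ} {l m : Finset (Fin 4) → ℝ} (h : QuasiTropical c l)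
    (h' : QuasiTropical c m) (hm : ∀ S, m S = l Sᶜ) :
    2 * l {0, 1, 2, 3} + l {1, 2} + l {1, 3} + l {2, 3} + l {0} + l ∅ ≤
      l {0, 1, 2} + l {0, 1, 3} + l {0, 2, 3} + l {1, 2, 3} + l {1} + l {2} + l {3} + 5 * c := by
  have e1 : ({1, 0} : Finset (Fin 4)) = {0, 1} := by decide
  have e2 : ({2, 0} : Finset (Fin 4)) = {0, 2} := by decide
  have e3 : ({3, 0} : Finset (Fin 4)) = {0, 3} := by decide
  have d0 : (∅ : Finset (Fin 4))ᶜ = {0, 1, 2, 3} := by decide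
  have d1 : ({0} : Finset (Fin 4))ᶜ = {1, 2, 3} := by decide
  have d2 : ({1} : Finset (Fin 4))ᶜ = {0, 2, 3} := by decide
  have d3 : ({2} : Finset (Fin 4))ᶜ = {0, 1, 3} := by decide
  have d4 : ({3} : Finset (Fin 4))ᶜ = {0, 1, 2} := by decide
  have d5 : ({0, 1} : Finset (Fin 4))ᶜ = {2, 3} := by decide
  have d6 : ({0, 2} : Finset (Fin 4))ᶜ = {1, 3} := by decide
  have d7 : ({0, 3} : Finset (Fin 4))ᶜ = {1, 2} := by decide
  have d8 : ({1, 2} : Finset (Fin 4))ᶜ = {0, 3} := by decide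
  have d9 : ({1, 3} : Finset (Fin 4))ᶜ = {0, 2} := by decide
  have d10 : ({2, 3} : Finset (Fin 4))ᶜ = {0, 1} := by decide
  have t1 := h.triangle (i := 1) (j := 2) (k := 0) (by decide) (by decide) (by decide)
  have t2 := h.triangle (i := 1) (j := 3) (k := 0) (by decide) (by decide) (by decide)
  have t3 := h.triangle (i := 2) (j := 3) (k := 0) (by decide) (by decide) (by decide)
  have v1 := h'.triangle (i := 1) (j := 2) (k := 0) (by decide) (by decide) (by decide)
  have v2 := h'.triangle (i := 1) (j := 3) (k := 0) (by decide) (by decide) (by decide)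
  have v3 := h'.triangle (i := 2) (j := 3) (k := 0) (by decide) (by decide) (by decide)
  have p1 := h.pair (i := 1) (j := 2) (by decide)
  have p2 := h.pair (i := 1) (j := 3) (by decide)
  have p3 := h.pair (i := 2) (j := 3) (by decide)
  have q1 := h'.pair (i := 0) (j := 1) (by decide)
  have q2 := h'.pair (i := 0) (j := 2) (by decide)
  have q3 := h'.pair (i := 0) (j := 3) (by decide)
  have hc := h.nonneg
  simp only [e1, e2, e3, hm, d0, d1, d2, d3, d4, d5, d6, d7, d8, d9, d10] at *
  rcases t1 with t1 | t1 <;> rcases t2 with t2 | t2 <;> rcases t3 with t3 | t3 <;>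
    rcases v1 with v1 | v1 <;> rcases v2 with v2 | v2 <;> rcases v3 with v3 | v3 <;> linarith

/-! ### Boundedness of the five generators and of their orbits. -/

section BoundedGenerators

variable {𝕜 : Type*} [RCLike 𝕜]

theorem boundedForm_ofSets {n : ℕ} {s t : List (Finset (Fin n))} {C : ℝ}
    (h : ∀ A : Matrix (Fin n) (Fin n) 𝕜, A.PosDef →
      (s.map fun S => Real.log (minor A S)).sum ≤
        (t.map fun S => Real.log (minor A S)).sum + C) :
    BoundedForm 𝕜 (Ratio.ofSets s t).log := by
  refine ⟨C, fun A hA => ?_⟩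
  rw [← Ratio.log_eval _ hA, Ratio.log_eval_ofSets _ _ hA]
  linarith [h A hA]

theorem boundedForm_K₁ : BoundedForm 𝕜 K₁.log := by
  refine boundedForm_ofSets (C := 0) fun A hA => ?_
  have h := (quasiTropical_log_minor hA).pair (i := 0) (j := 1) (by decide)
  simp only [List.map_cons, List.map_nil, List.sum_cons, List.sum_nil]
  linarith

theorem boundedForm_K₂ : BoundedForm 𝕜 K₂.log := by
  refine boundedForm_ofSets (C := 0) fun A hA => ?_
  have h := (quasiTropical_log_minor hA).triple (i := 0) (j := 1) (k := 2) (by decide)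
    (by decide) (by decide)
  simp only [List.map_cons, List.map_nil, List.sum_cons, List.sum_nil]
  linarith

theorem boundedForm_R₁ : BoundedForm 𝕜 R₁.log := by
  refine boundedForm_ofSets (C := 2 * Real.log 4) fun A hA => ?_
  have h := (quasiTropical_log_minor hA).log_R₁_le
  simp only [List.map_cons, List.map_nil, List.sum_cons, List.sum_nil]
  linarith

theorem boundedForm_R₂ : BoundedForm 𝕜 R₂.log := by
  refine boundedForm_ofSets (C := 5 * Real.log 4) fun A hA => ?_
  have h := (quasiTropical_log_minor hA).log_R₂_le (quasiTropical_log_minor_compl hA) fun _ => rfl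
  simp only [List.map_cons, List.map_nil, List.sum_cons, List.sum_nil]
  linarith

theorem boundedForm_R₃ : BoundedForm 𝕜 R₃.log := by
  refine boundedForm_ofSets (C := 3 * Real.log 4) fun A hA => ?_
  have h := (quasiTropical_log_minor hA).log_R₃_le (quasiTropical_log_minor_compl hA) fun _ => rfl
  simp only [List.map_cons, List.map_nil, List.sum_cons, List.sum_nil]
  linarith

theorem sum_permute {n : ℕ} (σ : Equiv.Perm (Fin n)) (x : Finset (Fin n) → ℝ) :
    ∑ S, permute σ x S = ∑ S, x S :=
  Fintype.sum_equiv (Equiv.finsetCongr σ.symm) _ _ fun _ => rfl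

theorem sum_complement {n : ℕ} (x : Finset (Fin n) → ℝ) : ∑ S, complement x S = ∑ S, x S :=
  Fintype.sum_equiv ⟨compl, compl, compl_compl, compl_compl⟩ _ _ fun _ => rfl

theorem sum_of_mem_orbit {n : ℕ} {r : Ratio n} {x : Finset (Fin n) → ℝ} (hx : x ∈ orbit r) :
    ∑ S, x S = 0 := by
  rcases hx with ⟨σ, rfl⟩ | ⟨_, ⟨σ, rfl⟩, rfl⟩
  · exact (sum_permute σ _).trans r.sum_log
  · exact (sum_complement _).trans ((sum_permute σ _).trans r.sum_log)

theorem BoundedForm.of_mem_orbit {n : ℕ} {r : Ratio n} (hr : BoundedForm 𝕜 r.log)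
    {x : Finset (Fin n) → ℝ} (hx : x ∈ orbit r) : BoundedForm 𝕜 x := by
  rcases hx with ⟨σ, rfl⟩ | ⟨_, ⟨σ, rfl⟩, rfl⟩
  · exact hr.permute σ
  · exact (hr.permute σ).complement ((sum_permute σ _).trans r.sum_log)

end BoundedGenerators

/-! ### Necessary conditions from degenerating families. -/

section DegenerateFamilies

open Filter Topology

variable {𝕜 : Type*} [RCLike 𝕜] {n : ℕ}

/-- The matrix `diag d + p pᵀ + q qᵀ`. -/
noncomputable def diagAddRankTwo (𝕜 : Type*) [RCLike 𝕜] {n : ℕ} (d p q : Fin n → ℝ) :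
    Matrix (Fin n) (Fin n) 𝕜 :=
  Matrix.diagonal (fun i => (d i : 𝕜)) +
    Matrix.of (fun i => ![(p i : 𝕜), (q i : 𝕜)]) *
      (Matrix.of fun i => ![(p i : 𝕜), (q i : 𝕜)]).conjTranspose

theorem posDef_diagAddRankTwo {d : Fin n → ℝ} (hd : ∀ i, 0 < d i) (p q : Fin n → ℝ) :
    (diagAddRankTwo 𝕜 d p q).PosDef :=
  (Matrix.PosDef.diagonal fun i => RCLike.ofReal_pos.mpr (hd i)).add_posSemidef
    (Matrix.posSemidef_self_mul_conjTranspose _)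

/-- This is the matrix determinant lemma `det (D + U Uᴴ) = det D * det (1 + Uᴴ D⁻¹ U)`, whose last
factor is a determinant of size two. -/
theorem minor_diagAddRankTwo {d : Fin n → ℝ} (hd : ∀ i, 0 < d i) (p q : Fin n → ℝ)
    (S : Finset (Fin n)) :
    minor (diagAddRankTwo 𝕜 d p q) S = (∏ i ∈ S, d i) *
      ((1 + ∑ i ∈ S, p i ^ 2 / d i) * (1 + ∑ i ∈ S, q i ^ 2 / d i) -
        (∑ i ∈ S, p i * q i / d i) ^ 2) := by
  have hd' : ∀ i : {i // i ∈ S}, (d i : 𝕜) ≠ 0 := fun i =>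
    RCLike.ofReal_ne_zero.mpr (hd i).ne'
  let D : Matrix {i // i ∈ S} {i // i ∈ S} 𝕜 := Matrix.diagonal fun i => (d i : 𝕜)
  let U : Matrix {i // i ∈ S} (Fin 2) 𝕜 := Matrix.of fun i => ![(p i : 𝕜), (q i : 𝕜)]
  have h1 : (diagAddRankTwo 𝕜 d p q).submatrix (fun i : {i // i ∈ S} => (i : Fin n))
      (fun i : {i // i ∈ S} => (i : Fin n)) = D + U * U.conjTranspose := by
    ext i j
    simp only [diagAddRankTwo, D, Matrix.submatrix_apply, Matrix.add_apply, Matrix.diagonal_apply,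
      Subtype.ext_iff]
    rfl
  have hD : IsUnit D.det := by
    rw [Matrix.det_diagonal]
    exact isUnit_iff_ne_zero.mpr (Finset.prod_ne_zero_iff.mpr fun i _ => hd' i)
  have hDinv : D⁻¹ = Matrix.diagonal fun i : {i // i ∈ S} => ((d i)⁻¹ : 𝕜) := by
    refine Matrix.inv_eq_right_inv ?_
    rw [Matrix.diagonal_mul_diagonal, ← Matrix.diagonal_one]
    congr 1
    funext i
    exact mul_inv_cancel₀ (hd' i)
  have hs : ∀ f : Fin n → ℝ, ∑ i : {i // i ∈ S}, (f i : 𝕜) = ((∑ i ∈ S, f i : ℝ) : 𝕜) := fun f => by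
    rw [RCLike.ofReal_sum, Finset.sum_coe_sort S fun i => (f i : 𝕜)]
  have hentry : ∀ a b, (1 + U.conjTranspose * D⁻¹ * U : Matrix (Fin 2) (Fin 2) 𝕜) a b =
      (((1 : Matrix (Fin 2) (Fin 2) ℝ) a b +
        ∑ i ∈ S, (![p i, q i] a * ![p i, q i] b / d i) : ℝ) : 𝕜) := by
    intro a b
    rw [hDinv, Matrix.add_apply, Matrix.mul_apply, RCLike.ofReal_add, ← hs]
    congr 1
    · simp [Matrix.one_apply, apply_ite]
    · refine Finset.sum_congr rfl fun i _ => ?_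
      rw [Matrix.mul_diagonal, Matrix.conjTranspose_apply]
      fin_cases a <;> fin_cases b <;> simp [U, div_eq_mul_inv] <;> ring
  rw [minor, h1, Matrix.det_add_mul _ _ hD, Matrix.det_fin_two]
  simp only [hentry]
  rw [Matrix.det_diagonal, Finset.prod_coe_sort S fun i => (d i : 𝕜), ← RCLike.ofReal_prod,
    ← RCLike.ofReal_mul, ← RCLike.ofReal_mul, ← RCLike.ofReal_sub, ← RCLike.ofReal_mul,
    RCLike.ofReal_re]
  simp [mul_comm, sq]

theorem tendsto_log_sub_order {f g : ℝ → ℝ} {m : ℝ} (hg : ContinuousAt g 0) (hg0 : 0 < g 0)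
    (hf : ∀ t, 0 < t → f t = t ^ m * g t) :
    Tendsto (fun t => Real.log (f t) - m * Real.log t) (𝓝[>] 0) (𝓝 (Real.log (g 0))) := by
  have h1 : Tendsto (fun t => Real.log (g t)) (𝓝[>] 0) (𝓝 (Real.log (g 0))) :=
    (hg.log hg0.ne').tendsto.mono_left nhdsWithin_le_nhds
  refine h1.congr' ?_
  have h2 : ∀ᶠ t in 𝓝[>] (0 : ℝ), 0 < g t :=
    (hg.tendsto.eventually_const_lt hg0).filter_mono nhdsWithin_le_nhds
  filter_upwards [h2, self_mem_nhdsWithin] with t ht ht'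
  rw [hf t ht', Real.log_mul (Real.rpow_pos_of_pos ht' _).ne' ht.ne', Real.log_rpow ht']
  ring

/-- Bounded forms are nonnegative on the vectors of orders of vanishing of the principal minors
along a degenerating family of positive definite matrices. -/
theorem BoundedForm.sum_mul_order_nonneg {x : Finset (Fin n) → ℝ} (hx : BoundedForm 𝕜 x)
    (A : ℝ → Matrix (Fin n) (Fin n) 𝕜) (hA : ∀ t, 0 < t → (A t).PosDef)
    (y : Finset (Fin n) → ℝ) (g : Finset (Fin n) → ℝ → ℝ) (hg : ∀ S, ContinuousAt (g S) 0)
    (hg0 : ∀ S, 0 < g S 0) (hm : ∀ S t, 0 < t → minor (A t) S = t ^ y S * g S t) :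
    0 ≤ ∑ S, x S * y S := by
  obtain ⟨C, hC⟩ := hx
  by_contra! hneg
  -- The form equals `(∑ x S * y S) * log t` plus a convergent term; a negative coefficient would
  -- send it to `+∞`.
  have h1 : Tendsto (fun t => ∑ S, x S * (Real.log (minor (A t) S) - y S * Real.log t))
      (𝓝[>] 0) (𝓝 (∑ S, x S * Real.log (g S 0))) :=
    tendsto_finsetSum _ fun S _ =>
      (tendsto_log_sub_order (hg S) (hg0 S) (hm S)).const_mul _
  have h2 : Tendsto (fun t => (∑ S, x S * y S) * Real.log t) (𝓝[>] 0) atTop :=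
    Real.tendsto_log_nhdsGT_zero.const_mul_atBot_of_neg hneg
  have h3 := h2.atTop_add h1
  obtain ⟨t, ht, ht'⟩ := ((h3.eventually_gt_atTop C).and self_mem_nhdsWithin).exists
  refine (hC (A t) (hA t ht')).not_gt (ht.trans_eq ?_)
  rw [Finset.sum_mul, ← Finset.sum_add_distrib]
  exact Finset.sum_congr rfl fun S _ => by ring

/-- On the diagonal matrix with `exp s` in place `i` and `1` elsewhere the form equals `s` times
this sum, and `s` takes both signs. -/
theorem BoundedForm.sum_mem_eq_zero {x : Finset (Fin n) → ℝ} (hx : BoundedForm 𝕜 x) (i : Fin n) :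
    ∑ S, (if i ∈ S then x S else 0) = 0 := by
  obtain ⟨C, hC⟩ := hx
  have h : ∀ s : ℝ, s * ∑ S, (if i ∈ S then x S else 0) ≤ C := fun s => by
    have hd : ∀ j, 0 < (fun j => if i = j then Real.exp s else 1) j := fun j => by
      dsimp only
      split_ifs
      exacts [Real.exp_pos s, one_pos]
    refine le_of_eq_of_le ?_ (hC _ (posDef_diagAddRankTwo hd 0 0))
    rw [Finset.mul_sum]
    refine Finset.sum_congr rfl fun S _ => ?_
    rw [minor_diagAddRankTwo hd]
    simp only [Finset.prod_ite_eq]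
    split_ifs <;> simp [mul_comm]
  by_contra hne
  have h1 := h ((C + 1) / ∑ S, (if i ∈ S then x S else 0))
  rw [div_mul_cancel₀ _ hne] at h1
  linarith

theorem BoundedForm.sum_mul_card_inter_eq_zero {x : Finset (Fin n) → ℝ} (hx : BoundedForm 𝕜 x)
    (B : Finset (Fin n)) : ∑ S, x S * ((S ∩ B).card : ℝ) = 0 := by
  have h : ∀ S : Finset (Fin n), x S * ((S ∩ B).card : ℝ) =
      ∑ i ∈ B, if i ∈ S then x S else 0 := fun S => by
    rw [← Finset.sum_filter, Finset.sum_const, Finset.filter_mem_eq_inter, Finset.inter_comm,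
      nsmul_eq_mul, mul_comm]
  simp only [h]
  rw [Finset.sum_comm]
  exact Finset.sum_eq_zero fun i _ => hx.sum_mem_eq_zero i

/-- The condition given by a family in which the rows with index in `B` become parallel. -/
theorem BoundedForm.sum_disjoint_nonneg {x : Finset (Fin n) → ℝ} (hx : BoundedForm 𝕜 x)
    (h0 : ∑ S, x S = 0) (B : Finset (Fin n)) :
    0 ≤ ∑ S, if S ∩ B = ∅ then x S else 0 := by
  have hd : ∀ t : ℝ, 0 < t → ∀ i, 0 < (fun i => if i ∈ B then t else 1) i := fun t ht i => by
    dsimp only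
    split_ifs
    exacts [ht, one_pos]
  have h := hx.sum_mul_order_nonneg
    (fun t => diagAddRankTwo 𝕜 (fun i => if i ∈ B then t else 1) (fun i => if i ∈ B then 1 else 0) 0)
    (fun t ht => posDef_diagAddRankTwo (hd t ht) _ _)
    -- The block on `S ∩ B` is `t` times the identity plus the all-ones matrix, so its order of
    -- vanishing is `|S ∩ B| - 1`, or `0` if it is empty. The terms `|S ∩ B|` and `-1` pair to `0`
    -- with `x`.
    (fun S => (S ∩ B).card - 1 + if S ∩ B = ∅ then 1 else 0)
    (fun S t => if S ∩ B = ∅ then 1 else t + (S ∩ B).card) ?_ ?_ ?_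
  · simp only [mul_add, mul_sub, mul_one, Finset.sum_add_distrib, Finset.sum_sub_distrib,
      hx.sum_mul_card_inter_eq_zero B, h0, mul_ite, mul_zero] at h
    linarith
  · intro S
    split_ifs
    · exact continuousAt_const
    · exact continuousAt_id.add continuousAt_const
  · intro S
    split_ifs with hS
    · exact one_pos
    · rw [zero_add, Nat.cast_pos]
      exact Finset.card_pos.mpr (Finset.nonempty_iff_ne_empty.mpr hS)
  · intro S t ht
    have e1 : ∏ i ∈ S, (if i ∈ B then t else 1) = t ^ (S ∩ B).card := by
      rw [← Finset.prod_filter, Finset.prod_const, Finset.filter_mem_eq_inter]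
    have e2 : ∑ i ∈ S, (if i ∈ B then (1 : ℝ) else 0) ^ 2 / (if i ∈ B then t else 1) =
        (S ∩ B).card / t := by
      rw [Finset.sum_congr rfl fun i _ => show (if i ∈ B then (1 : ℝ) else 0) ^ 2 /
        (if i ∈ B then t else 1) = if i ∈ B then 1 / t else 0 by split_ifs <;> simp,
        ← Finset.sum_filter, Finset.sum_const, Finset.filter_mem_eq_inter, nsmul_eq_mul]
      ring
    rw [minor_diagAddRankTwo (hd t ht), e1, e2]
    split_ifs with hS
    · simp [hS]
    · rw [add_zero, Real.rpow_sub ht, Real.rpow_natCast, Real.rpow_one]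
      simp
      field_simp

theorem BoundedForm.sum_superset_nonneg {x : Finset (Fin n) → ℝ} (hx : BoundedForm 𝕜 x)
    (h0 : ∑ S, x S = 0) (B : Finset (Fin n)) :
    0 ≤ ∑ S, if B ⊆ S then x S else 0 := by
  refine ((hx.complement h0).sum_disjoint_nonneg ((sum_complement x).trans h0) B).trans_eq ?_
  refine Fintype.sum_equiv ⟨compl, compl, compl_compl, compl_compl⟩ _ _ fun S => ?_
  have h : S ∩ B = ∅ ↔ B ⊆ Sᶜ := by
    rw [← Finset.disjoint_iff_inter_eq_empty, disjoint_comm, Finset.subset_compl_iff_disjoint_right]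
  simp [PDRatio.complement, h]

/-- The condition given by a family degenerating to a Gram matrix of vectors `(p i, q i)`. -/
theorem BoundedForm.sum_corank_nonneg {x : Finset (Fin n) → ℝ} (hx : BoundedForm 𝕜 x)
    (h0 : ∑ S, x S = 0) (p q : Fin n → ℤ) (o : Finset (Fin n) → ℕ)
    (ho : ∀ S : Finset (Fin n),
      (o S = 0 ∧ 0 < (∑ i ∈ S, p i ^ 2) * (∑ i ∈ S, q i ^ 2) - (∑ i ∈ S, p i * q i) ^ 2) ∨
      (o S = 1 ∧ (∑ i ∈ S, p i ^ 2) * (∑ i ∈ S, q i ^ 2) - (∑ i ∈ S, p i * q i) ^ 2 = 0 ∧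
        0 < ∑ i ∈ S, p i ^ 2 + ∑ i ∈ S, q i ^ 2) ∨ (o S = 2 ∧ S = ∅)) :
    0 ≤ ∑ S, x S * o S := by
  have hd : ∀ t : ℝ, 0 < t → ∀ i, 0 < (fun _ : Fin n => t) i := fun t ht _ => ht
  have h := hx.sum_mul_order_nonneg
    (fun t => diagAddRankTwo 𝕜 (fun _ => t) (fun i => p i) (fun i => q i))
    (fun t ht => posDef_diagAddRankTwo (hd t ht) _ _)
    -- The order is `|S|` minus the rank of the vectors indexed by `S`, with `o S` equal to `2`
    -- minus that rank. Intersecting with `univ` matches `sum_mul_card_inter_eq_zero`.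
    (fun S => (S ∩ Finset.univ).card - 2 + o S)
    -- The minor is `t ^ (|S| - 2)` times `t ^ 2 + t * trace + det` of the `2 × 2` Gram matrix; `g`
    -- is this polynomial divided by `t ^ o S`.
    (fun S t => if o S = 0 then t ^ 2 + t * ((∑ i ∈ S, p i ^ 2 + ∑ i ∈ S, q i ^ 2 : ℤ) : ℝ) +
        (((∑ i ∈ S, p i ^ 2) * (∑ i ∈ S, q i ^ 2) - (∑ i ∈ S, p i * q i) ^ 2 : ℤ) : ℝ)
      else if o S = 1 then t + ((∑ i ∈ S, p i ^ 2 + ∑ i ∈ S, q i ^ 2 : ℤ) : ℝ) else 1) ?_ ?_ ?_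
  · simp only [mul_add, mul_sub, Finset.sum_add_distrib, Finset.sum_sub_distrib,
      hx.sum_mul_card_inter_eq_zero Finset.univ, ← Finset.sum_mul, h0] at h
    linarith
  · intro S
    split_ifs <;> fun_prop
  · intro S
    rcases ho S with ⟨h1, h2⟩ | ⟨h1, -, h2⟩ | ⟨h1, -⟩
    · simp only [h1, if_true]
      have := (Int.cast_pos (R := ℝ)).mpr h2
      linarith
    · have := (Int.cast_pos (R := ℝ)).mpr h2
      simpa [h1] using this
    · simp [h1]
  · intro S t ht
    have e : ∀ f : Fin n → ℤ, ∑ i ∈ S, ((f i : ℤ) : ℝ) / t = ((∑ i ∈ S, f i : ℤ) : ℝ) / t :=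
      fun f => by rw [Int.cast_sum, Finset.sum_div]
    have e1 := e fun i => p i ^ 2
    have e2 := e fun i => q i ^ 2
    have e3 := e fun i => p i * q i
    simp only [Int.cast_pow, Int.cast_mul] at e1 e2 e3
    have e4 : t ^ ((S.card : ℝ) - 2 + o S) = t ^ S.card * t ^ o S / t ^ 2 := by
      rw [Real.rpow_add ht, Real.rpow_sub ht, Real.rpow_natCast, Real.rpow_natCast, div_mul_eq_mul_div]
      norm_num
    rw [minor_diagAddRankTwo (hd t ht), Finset.prod_const, e1, e2, e3, Finset.inter_univ, e4]
    rcases ho S with ⟨h1, h2⟩ | ⟨h1, h2, -⟩ | ⟨h1, rfl⟩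
    · simp only [h1, if_true]
      push_cast
      field_simp
      ring
    · have h3 := congrArg (Int.cast (R := ℝ)) h2
      push_cast at h3
      simp only [h1, if_true, one_ne_zero, if_false]
      push_cast
      field_simp
      linear_combination h3
    · simp [h1, ht.ne']

end DegenerateFamilies

/-! ### Combinatorics of the facets. -/

/-- The sets of facets that do not contain the respective generator in `genRows`. -/
def supports : List (List ℕ) :=
  [[0, 5, 6, 11, 22],
   [0, 4, 6, 12, 21],
   [0, 3, 6, 14, 19],
   [0, 4, 5, 13, 20],
   [0, 3, 5, 15, 18],
   [0, 3, 4, 16, 17],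
   [1, 9, 10, 11, 17],
   [1, 8, 10, 12, 18],
   [1, 8, 9, 13, 19],
   [1, 7, 10, 14, 20],
   [1, 7, 9, 15, 21],
   [1, 7, 8, 16, 22],
   [2, 5, 10, 11, 17, 18, 20, 22],
   [2, 4, 10, 12, 17, 18, 20, 21],
   [2, 3, 10, 14, 17, 18, 19, 20],
   [2, 6, 9, 11, 17, 19, 21, 22],
   [2, 4, 9, 13, 17, 19, 20, 21],
   [2, 3, 9, 15, 17, 18, 19, 21],
   [2, 6, 8, 12, 18, 19, 21, 22],
   [2, 5, 8, 13, 18, 19, 20, 22],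
   [2, 3, 8, 16, 17, 18, 19, 22],
   [2, 6, 7, 14, 19, 20, 21, 22],
   [2, 5, 7, 15, 18, 20, 21, 22],
   [2, 4, 7, 16, 17, 20, 21, 22],
   [2, 3, 4, 9, 10, 11, 16, 17, 18, 19, 20, 21, 22],
   [2, 3, 5, 8, 10, 12, 15, 17, 18, 19, 20, 21, 22],
   [2, 3, 6, 8, 9, 13, 14, 17, 18, 19, 20, 21, 22],
   [2, 4, 5, 7, 10, 13, 14, 17, 18, 19, 20, 21, 22],
   [2, 4, 6, 7, 9, 12, 15, 17, 18, 19, 20, 21, 22],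
   [2, 5, 6, 7, 8, 11, 16, 17, 18, 19, 20, 21, 22],
   [0, 1, 3, 4, 5, 6, 10, 11, 12, 14, 17, 18, 20],
   [0, 1, 3, 4, 5, 6, 9, 11, 13, 15, 17, 19, 21],
   [0, 1, 3, 4, 5, 6, 8, 12, 13, 16, 18, 19, 22],
   [0, 1, 3, 4, 5, 6, 7, 14, 15, 16, 20, 21, 22],
   [0, 1, 6, 7, 8, 9, 10, 11, 12, 14, 19, 21, 22],
   [0, 1, 5, 7, 8, 9, 10, 11, 13, 15, 18, 20, 22],
   [0, 1, 4, 7, 8, 9, 10, 12, 13, 16, 17, 20, 21],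
   [0, 1, 3, 7, 8, 9, 10, 14, 15, 16, 17, 18, 19],
   [0, 1, 2, 3, 4, 5, 10, 11, 12, 14, 17, 18, 20],
   [0, 1, 2, 3, 4, 6, 9, 11, 13, 15, 17, 19, 21],
   [0, 1, 2, 3, 8, 9, 10, 14, 15, 16, 17, 18, 19],
   [0, 1, 2, 3, 5, 6, 8, 12, 13, 16, 18, 19, 22],
   [0, 1, 2, 4, 7, 9, 10, 12, 13, 16, 17, 20, 21],
   [0, 1, 2, 5, 7, 8, 10, 11, 13, 15, 18, 20, 22],
   [0, 1, 2, 6, 7, 8, 9, 11, 12, 14, 19, 21, 22],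
   [0, 1, 2, 4, 5, 6, 7, 14, 15, 16, 20, 21, 22]]

set_option maxHeartbeats 4000000 in
-- Here `z i` stands for the value of the `i`-th facet form. The five modular equations leave a
-- space of dimension 11, on which the 23 forms satisfy the 12 relations `e0`, …, `e11`. The
-- hypothesis `hc` excludes the zero vector.
theorem exists_support_pos {z : ℕ → ℝ} (hz : ∀ i < 23, 0 ≤ z i)
    (e0 : z 3 + z 4 + z 5 + z 6 = 2 * z 0 + z 2)
    (e1 : z 7 + z 8 + z 9 + z 10 = 2 * z 1 + z 2)
    (e2 : z 11 + z 3 + z 4 = z 17 + z 0)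
    (e3 : z 12 + z 3 + z 5 = z 18 + z 0)
    (e4 : z 13 + z 3 + z 6 = z 19 + z 0)
    (e5 : z 14 + z 4 + z 5 = z 20 + z 0)
    (e6 : z 15 + z 4 + z 6 = z 21 + z 0)
    (e7 : z 16 + z 5 + z 6 = z 22 + z 0)
    (e8 : z 3 + z 7 = z 14 + z 15 + z 16)
    (e9 : z 4 + z 8 = z 12 + z 13 + z 16)
    (e10 : z 5 + z 9 = z 11 + z 13 + z 15)
    (e11 : z 6 + z 10 = z 11 + z 12 + z 14)
    (hc : 0 < z 11 + z 12 + z 13 + z 14 + z 15 + z 16) :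
    ∃ s ∈ supports, ∀ i ∈ s, 0 < z i := by
  by_contra hs
  -- On an explicit list `List.Forall` unfolds to a conjunction, which the anonymous constructors
  -- below split.
  have g : ∀ s ∈ supports, ¬ List.Forall (fun i => 0 < z i) s := fun s hm hf =>
    hs ⟨s, hm, List.forall_iff_forall_mem.mp hf⟩
  have h0 := hz 0 (by norm_num)
  have h1 := hz 1 (by norm_num)
  have h2 := hz 2 (by norm_num)
  have h3 := hz 3 (by norm_num)
  have h4 := hz 4 (by norm_num)
  have h5 := hz 5 (by norm_num)
  have h6 := hz 6 (by norm_num)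
  have h7 := hz 7 (by norm_num)
  have h8 := hz 8 (by norm_num)
  have h9 := hz 9 (by norm_num)
  have h10 := hz 10 (by norm_num)
  have h11 := hz 11 (by norm_num)
  have h12 := hz 12 (by norm_num)
  have h13 := hz 13 (by norm_num)
  have h14 := hz 14 (by norm_num)
  have h15 := hz 15 (by norm_num)
  have h16 := hz 16 (by norm_num)
  have h17 := hz 17 (by norm_num)
  have h18 := hz 18 (by norm_num)
  have h19 := hz 19 (by norm_num)
  have h20 := hz 20 (by norm_num)
  have h21 := hz 21 (by norm_num)
  have h22 := hz 22 (by norm_num)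
  clear hz hs
  -- A decision tree on which `z i` vanish. Each leaf names a support whose entries are all forced
  -- to be positive by the signs chosen on the way and the relations; the shadowed hypotheses `h`
  -- remain available.
  rcases h15.eq_or_lt with h | h
  · rcases h14.eq_or_lt with h | h
    · rcases h20.eq_or_lt with h | h
      · rcases h2.eq_or_lt with h | h
        · rcases h3.eq_or_lt with h | h
          · rcases h0.eq_or_lt with h | h
            · rcases h7.eq_or_lt with h | h
              · rcases h8.eq_or_lt with h | h
                · refine g [1, 9, 10, 11, 17] (by decide) ⟨?_, ?_, ?_, ?_, ?_⟩ <;>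
                    first | assumption | (change 0 < _; linarith)
                · rcases h12.eq_or_lt with h | h
                  · refine g [1, 8, 9, 13, 19] (by decide) ⟨?_, ?_, ?_, ?_, ?_⟩ <;>
                      first | assumption | (change 0 < _; linarith)
                  · refine g [1, 8, 10, 12, 18] (by decide) ⟨?_, ?_, ?_, ?_, ?_⟩ <;>
                      first | assumption | (change 0 < _; linarith)
              · refine g [1, 7, 8, 16, 22] (by decide) ⟨?_, ?_, ?_, ?_, ?_⟩ <;>
                  first | assumption | (change 0 < _; linarith)
            · rcases h4.eq_or_lt with h | h
              · refine g [0, 5, 6, 11, 22] (by decide) ⟨?_, ?_, ?_, ?_, ?_⟩ <;>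
                  first | assumption | (change 0 < _; linarith)
              · refine g [0, 4, 6, 12, 21] (by decide) ⟨?_, ?_, ?_, ?_, ?_⟩ <;>
                  first | assumption | (change 0 < _; linarith)
          · rcases h17.eq_or_lt with h | h
            · refine g [0, 1, 3, 4, 5, 6, 8, 12, 13, 16, 18, 19, 22] (by decide) ⟨?_, ?_, ?_, ?_, ?_, ?_, ?_, ?_, ?_, ?_, ?_, ?_, ?_⟩ <;>
                first | assumption | (change 0 < _; linarith)
            · refine g [0, 3, 4, 16, 17] (by decide) ⟨?_, ?_, ?_, ?_, ?_⟩ <;>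
                first | assumption | (change 0 < _; linarith)
        · rcases h18.eq_or_lt with h | h
          · refine g [2, 6, 9, 11, 17, 19, 21, 22] (by decide) ⟨?_, ?_, ?_, ?_, ?_, ?_, ?_, ?_⟩ <;>
              first | assumption | (change 0 < _; linarith)
          · rcases h3.eq_or_lt with h | h
            · refine g [2, 6, 8, 12, 18, 19, 21, 22] (by decide) ⟨?_, ?_, ?_, ?_, ?_, ?_, ?_, ?_⟩ <;>
                first | assumption | (change 0 < _; linarith)
            · rcases h17.eq_or_lt with h | h
              · refine g [0, 1, 2, 3, 5, 6, 8, 12, 13, 16, 18, 19, 22] (by decide) ⟨?_, ?_, ?_, ?_, ?_, ?_, ?_, ?_, ?_, ?_, ?_, ?_, ?_⟩ <;>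
                  first | assumption | (change 0 < _; linarith)
              · refine g [2, 3, 8, 16, 17, 18, 19, 22] (by decide) ⟨?_, ?_, ?_, ?_, ?_, ?_, ?_, ?_⟩ <;>
                  first | assumption | (change 0 < _; linarith)
      · rcases h13.eq_or_lt with h | h
        · rcases h21.eq_or_lt with h | h
          · refine g [2, 5, 10, 11, 17, 18, 20, 22] (by decide) ⟨?_, ?_, ?_, ?_, ?_, ?_, ?_, ?_⟩ <;>
              first | assumption | (change 0 < _; linarith)
          · rcases h4.eq_or_lt with h | h
            · rcases h7.eq_or_lt with h | h
              · refine g [2, 5, 10, 11, 17, 18, 20, 22] (by decide) ⟨?_, ?_, ?_, ?_, ?_, ?_, ?_, ?_⟩ <;>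
                  first | assumption | (change 0 < _; linarith)
              · refine g [2, 5, 6, 7, 8, 11, 16, 17, 18, 19, 20, 21, 22] (by decide) ⟨?_, ?_, ?_, ?_, ?_, ?_, ?_, ?_, ?_, ?_, ?_, ?_, ?_⟩ <;>
                  first | assumption | (change 0 < _; linarith)
            · rcases h7.eq_or_lt with h | h
              · rcases h12.eq_or_lt with h | h
                · refine g [2, 3, 4, 9, 10, 11, 16, 17, 18, 19, 20, 21, 22] (by decide) ⟨?_, ?_, ?_, ?_, ?_, ?_, ?_, ?_, ?_, ?_, ?_, ?_, ?_⟩ <;>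
                    first | assumption | (change 0 < _; linarith)
                · refine g [2, 4, 10, 12, 17, 18, 20, 21] (by decide) ⟨?_, ?_, ?_, ?_, ?_, ?_, ?_, ?_⟩ <;>
                    first | assumption | (change 0 < _; linarith)
              · refine g [2, 4, 7, 16, 17, 20, 21, 22] (by decide) ⟨?_, ?_, ?_, ?_, ?_, ?_, ?_, ?_⟩ <;>
                  first | assumption | (change 0 < _; linarith)
        · rcases h0.eq_or_lt with h | h
          · rcases h4.eq_or_lt with h | h
            · refine g [2, 5, 8, 13, 18, 19, 20, 22] (by decide) ⟨?_, ?_, ?_, ?_, ?_, ?_, ?_, ?_⟩ <;>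
                first | assumption | (change 0 < _; linarith)
            · rcases h9.eq_or_lt with h | h
              · refine g [2, 5, 8, 13, 18, 19, 20, 22] (by decide) ⟨?_, ?_, ?_, ?_, ?_, ?_, ?_, ?_⟩ <;>
                  first | assumption | (change 0 < _; linarith)
              · refine g [2, 4, 9, 13, 17, 19, 20, 21] (by decide) ⟨?_, ?_, ?_, ?_, ?_, ?_, ?_, ?_⟩ <;>
                  first | assumption | (change 0 < _; linarith)
          · rcases h2.eq_or_lt with h | h
            · rcases h5.eq_or_lt with h | h
              · refine g [0, 1, 4, 7, 8, 9, 10, 12, 13, 16, 17, 20, 21] (by decide) ⟨?_, ?_, ?_, ?_, ?_, ?_, ?_, ?_, ?_, ?_, ?_, ?_, ?_⟩ <;>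
                  first | assumption | (change 0 < _; linarith)
              · refine g [0, 4, 5, 13, 20] (by decide) ⟨?_, ?_, ?_, ?_, ?_⟩ <;>
                  first | assumption | (change 0 < _; linarith)
            · rcases h4.eq_or_lt with h | h
              · refine g [2, 5, 8, 13, 18, 19, 20, 22] (by decide) ⟨?_, ?_, ?_, ?_, ?_, ?_, ?_, ?_⟩ <;>
                  first | assumption | (change 0 < _; linarith)
              · rcases h5.eq_or_lt with h | h
                · rcases h19.eq_or_lt with h | h
                  · refine g [0, 1, 2, 4, 7, 9, 10, 12, 13, 16, 17, 20, 21] (by decide) ⟨?_, ?_, ?_, ?_, ?_, ?_, ?_, ?_, ?_, ?_, ?_, ?_, ?_⟩ <;>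
                      first | assumption | (change 0 < _; linarith)
                  · refine g [2, 4, 9, 13, 17, 19, 20, 21] (by decide) ⟨?_, ?_, ?_, ?_, ?_, ?_, ?_, ?_⟩ <;>
                      first | assumption | (change 0 < _; linarith)
                · refine g [0, 4, 5, 13, 20] (by decide) ⟨?_, ?_, ?_, ?_, ?_⟩ <;>
                    assumption
    · rcases h20.eq_or_lt with h | h
      · rcases h3.eq_or_lt with h | h
        · rcases h2.eq_or_lt with h | h
          · refine g [0, 1, 6, 7, 8, 9, 10, 11, 12, 14, 19, 21, 22] (by decide) ⟨?_, ?_, ?_, ?_, ?_, ?_, ?_, ?_, ?_, ?_, ?_, ?_, ?_⟩ <;>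
              first | assumption | (change 0 < _; linarith)
          · refine g [0, 1, 2, 6, 7, 8, 9, 11, 12, 14, 19, 21, 22] (by decide) ⟨?_, ?_, ?_, ?_, ?_, ?_, ?_, ?_, ?_, ?_, ?_, ?_, ?_⟩ <;>
              first | assumption | (change 0 < _; linarith)
        · refine g [0, 3, 6, 14, 19] (by decide) ⟨?_, ?_, ?_, ?_, ?_⟩ <;>
            first | assumption | (change 0 < _; linarith)
      · rcases h19.eq_or_lt with h | h
        · rcases h7.eq_or_lt with h | h
          · rcases h2.eq_or_lt with h | h
            · refine g [0, 1, 3, 4, 5, 6, 10, 11, 12, 14, 17, 18, 20] (by decide) ⟨?_, ?_, ?_, ?_, ?_, ?_, ?_, ?_, ?_, ?_, ?_, ?_, ?_⟩ <;>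
                first | assumption | (change 0 < _; linarith)
            · refine g [0, 1, 2, 3, 4, 5, 10, 11, 12, 14, 17, 18, 20] (by decide) ⟨?_, ?_, ?_, ?_, ?_, ?_, ?_, ?_, ?_, ?_, ?_, ?_, ?_⟩ <;>
                first | assumption | (change 0 < _; linarith)
          · refine g [1, 7, 10, 14, 20] (by decide) ⟨?_, ?_, ?_, ?_, ?_⟩ <;>
              first | assumption | (change 0 < _; linarith)
        · rcases h6.eq_or_lt with h | h
          · rcases h1.eq_or_lt with h | h
            · rcases h3.eq_or_lt with h | h
              · refine g [2, 4, 5, 7, 10, 13, 14, 17, 18, 19, 20, 21, 22] (by decide) ⟨?_, ?_, ?_, ?_, ?_, ?_, ?_, ?_, ?_, ?_, ?_, ?_, ?_⟩ <;>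
                  first | assumption | (change 0 < _; linarith)
              · refine g [2, 3, 10, 14, 17, 18, 19, 20] (by decide) ⟨?_, ?_, ?_, ?_, ?_, ?_, ?_, ?_⟩ <;>
                  first | assumption | (change 0 < _; linarith)
            · rcases h7.eq_or_lt with h | h
              · refine g [2, 3, 10, 14, 17, 18, 19, 20] (by decide) ⟨?_, ?_, ?_, ?_, ?_, ?_, ?_, ?_⟩ <;>
                  first | assumption | (change 0 < _; linarith)
              · refine g [1, 7, 10, 14, 20] (by decide) ⟨?_, ?_, ?_, ?_, ?_⟩ <;>
                  first | assumption | (change 0 < _; linarith)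
          · rcases h0.eq_or_lt with h | h
            · rcases h7.eq_or_lt with h | h
              · rcases h10.eq_or_lt with h | h
                · refine g [2, 3, 6, 8, 9, 13, 14, 17, 18, 19, 20, 21, 22] (by decide) ⟨?_, ?_, ?_, ?_, ?_, ?_, ?_, ?_, ?_, ?_, ?_, ?_, ?_⟩ <;>
                    first | assumption | (change 0 < _; linarith)
                · refine g [2, 3, 10, 14, 17, 18, 19, 20] (by decide) ⟨?_, ?_, ?_, ?_, ?_, ?_, ?_, ?_⟩ <;>
                    first | assumption | (change 0 < _; linarith)
              · refine g [2, 6, 7, 14, 19, 20, 21, 22] (by decide) ⟨?_, ?_, ?_, ?_, ?_, ?_, ?_, ?_⟩ <;>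
                  first | assumption | (change 0 < _; linarith)
            · rcases h3.eq_or_lt with h | h
              · rcases h1.eq_or_lt with h | h
                · refine g [2, 6, 7, 14, 19, 20, 21, 22] (by decide) ⟨?_, ?_, ?_, ?_, ?_, ?_, ?_, ?_⟩ <;>
                    first | assumption | (change 0 < _; linarith)
                · rcases h10.eq_or_lt with h | h
                  · refine g [2, 6, 7, 14, 19, 20, 21, 22] (by decide) ⟨?_, ?_, ?_, ?_, ?_, ?_, ?_, ?_⟩ <;>
                      first | assumption | (change 0 < _; linarith)
                  · refine g [1, 7, 10, 14, 20] (by decide) ⟨?_, ?_, ?_, ?_, ?_⟩ <;>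
                      first | assumption | (change 0 < _; linarith)
              · refine g [0, 3, 6, 14, 19] (by decide) ⟨?_, ?_, ?_, ?_, ?_⟩ <;>
                  assumption
  · rcases h5.eq_or_lt with h | h
    · rcases h7.eq_or_lt with h | h
      · rcases h18.eq_or_lt with h | h
        · refine g [0, 1, 2, 3, 4, 6, 9, 11, 13, 15, 17, 19, 21] (by decide) ⟨?_, ?_, ?_, ?_, ?_, ?_, ?_, ?_, ?_, ?_, ?_, ?_, ?_⟩ <;>
            first | assumption | (change 0 < _; linarith)
        · rcases h21.eq_or_lt with h | h
          · refine g [0, 1, 2, 3, 8, 9, 10, 14, 15, 16, 17, 18, 19] (by decide) ⟨?_, ?_, ?_, ?_, ?_, ?_, ?_, ?_, ?_, ?_, ?_, ?_, ?_⟩ <;>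
              first | assumption | (change 0 < _; linarith)
          · refine g [2, 3, 9, 15, 17, 18, 19, 21] (by decide) ⟨?_, ?_, ?_, ?_, ?_, ?_, ?_, ?_⟩ <;>
              first | assumption | (change 0 < _; linarith)
      · rcases h1.eq_or_lt with h | h
        · rcases h3.eq_or_lt with h | h
          · refine g [2, 4, 6, 7, 9, 12, 15, 17, 18, 19, 20, 21, 22] (by decide) ⟨?_, ?_, ?_, ?_, ?_, ?_, ?_, ?_, ?_, ?_, ?_, ?_, ?_⟩ <;>
              first | assumption | (change 0 < _; linarith)
          · refine g [2, 3, 9, 15, 17, 18, 19, 21] (by decide) ⟨?_, ?_, ?_, ?_, ?_, ?_, ?_, ?_⟩ <;>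
              first | assumption | (change 0 < _; linarith)
        · rcases h21.eq_or_lt with h | h
          · refine g [0, 1, 3, 7, 8, 9, 10, 14, 15, 16, 17, 18, 19] (by decide) ⟨?_, ?_, ?_, ?_, ?_, ?_, ?_, ?_, ?_, ?_, ?_, ?_, ?_⟩ <;>
              first | assumption | (change 0 < _; linarith)
          · refine g [1, 7, 9, 15, 21] (by decide) ⟨?_, ?_, ?_, ?_, ?_⟩ <;>
              first | assumption | (change 0 < _; linarith)
    · rcases h0.eq_or_lt with h | h
      · rcases h7.eq_or_lt with h | h
        · rcases h9.eq_or_lt with h | h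
          · refine g [2, 3, 5, 8, 10, 12, 15, 17, 18, 19, 20, 21, 22] (by decide) ⟨?_, ?_, ?_, ?_, ?_, ?_, ?_, ?_, ?_, ?_, ?_, ?_, ?_⟩ <;>
              first | assumption | (change 0 < _; linarith)
          · refine g [2, 3, 9, 15, 17, 18, 19, 21] (by decide) ⟨?_, ?_, ?_, ?_, ?_, ?_, ?_, ?_⟩ <;>
              first | assumption | (change 0 < _; linarith)
        · refine g [2, 5, 7, 15, 18, 20, 21, 22] (by decide) ⟨?_, ?_, ?_, ?_, ?_, ?_, ?_, ?_⟩ <;>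
            first | assumption | (change 0 < _; linarith)
      · rcases h3.eq_or_lt with h | h
        · rcases h21.eq_or_lt with h | h
          · rcases h2.eq_or_lt with h | h
            · refine g [0, 1, 5, 7, 8, 9, 10, 11, 13, 15, 18, 20, 22] (by decide) ⟨?_, ?_, ?_, ?_, ?_, ?_, ?_, ?_, ?_, ?_, ?_, ?_, ?_⟩ <;>
                first | assumption | (change 0 < _; linarith)
            · refine g [0, 1, 2, 5, 7, 8, 10, 11, 13, 15, 18, 20, 22] (by decide) ⟨?_, ?_, ?_, ?_, ?_, ?_, ?_, ?_, ?_, ?_, ?_, ?_, ?_⟩ <;>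
                first | assumption | (change 0 < _; linarith)
          · rcases h1.eq_or_lt with h | h
            · refine g [2, 5, 7, 15, 18, 20, 21, 22] (by decide) ⟨?_, ?_, ?_, ?_, ?_, ?_, ?_, ?_⟩ <;>
                first | assumption | (change 0 < _; linarith)
            · rcases h9.eq_or_lt with h | h
              · rcases h18.eq_or_lt with h | h
                · refine g [0, 1, 2, 4, 5, 6, 7, 14, 15, 16, 20, 21, 22] (by decide) ⟨?_, ?_, ?_, ?_, ?_, ?_, ?_, ?_, ?_, ?_, ?_, ?_, ?_⟩ <;>
                    first | assumption | (change 0 < _; linarith)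
                · refine g [2, 5, 7, 15, 18, 20, 21, 22] (by decide) ⟨?_, ?_, ?_, ?_, ?_, ?_, ?_, ?_⟩ <;>
                    first | assumption | (change 0 < _; linarith)
              · refine g [1, 7, 9, 15, 21] (by decide) ⟨?_, ?_, ?_, ?_, ?_⟩ <;>
                  first | assumption | (change 0 < _; linarith)
        · rcases h18.eq_or_lt with h | h
          · rcases h7.eq_or_lt with h | h
            · refine g [0, 1, 3, 4, 5, 6, 9, 11, 13, 15, 17, 19, 21] (by decide) ⟨?_, ?_, ?_, ?_, ?_, ?_, ?_, ?_, ?_, ?_, ?_, ?_, ?_⟩ <;>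
                first | assumption | (change 0 < _; linarith)
            · rcases h9.eq_or_lt with h | h
              · refine g [0, 1, 3, 4, 5, 6, 7, 14, 15, 16, 20, 21, 22] (by decide) ⟨?_, ?_, ?_, ?_, ?_, ?_, ?_, ?_, ?_, ?_, ?_, ?_, ?_⟩ <;>
                  first | assumption | (change 0 < _; linarith)
              · refine g [1, 7, 9, 15, 21] (by decide) ⟨?_, ?_, ?_, ?_, ?_⟩ <;>
                  first | assumption | (change 0 < _; linarith)
          · refine g [0, 3, 5, 15, 18] (by decide) ⟨?_, ?_, ?_, ?_, ?_⟩ <;>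
              assumption

/-! ### Encoding of vectors and forms by integer rows. -/

/-- The position of a subset of `Fin 4` in the rows below. -/
def code (S : Finset (Fin 4)) : ℕ := ∑ i ∈ S, 2 ^ (i : ℕ)

/-- The subset of `Fin 4` at a given position. -/
def decode (k : ℕ) : Finset (Fin 4) := Finset.univ.filter fun i => k.testBit i

theorem decode_code : ∀ S, decode (code S) = S := by decide +kernel

theorem code_decode : ∀ k : Fin 16, code (decode k) = k := by decide +kernel

theorem code_lt : ∀ S, code S < 16 := by decide +kernel

theorem sum_eq_sum_decode {M : Type*} [AddCommMonoid M] (f : Finset (Fin 4) → M) :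
    ∑ S, f S = ∑ k : Fin 16, f (decode k) :=
  Fintype.sum_equiv ⟨fun S => (⟨code S, code_lt S⟩ : Fin 16), fun k => decode k, decode_code,
    fun k => Fin.ext (code_decode k)⟩ _ _ fun S => congrArg f (decode_code S).symm

/-- The integer row of values of a function of subsets. -/
def rowOf (y : Finset (Fin 4) → ℤ) : List ℤ := (List.range 16).map fun k => y (decode k)

/-- The vector with a given integer row of entries. -/
def rowVec (v : List ℤ) : Finset (Fin 4) → ℝ := fun S => v.getD (code S) 0

/-- The linear form with a given integer row of coefficients. -/
def form (f : List ℤ) (x : Finset (Fin 4) → ℝ) : ℝ :=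
  ∑ k : Fin 16, (f.getD k 0 : ℝ) * x (decode k)

/-- The pairing of integer rows. -/
def dotRow (f v : List ℤ) : ℤ := ∑ k : Fin 16, f.getD k 0 * v.getD k 0

theorem form_rowVec (f v : List ℤ) : form f (rowVec v) = dotRow f v := by
  simp [form, rowVec, dotRow, code_decode]

theorem form_add (f : List ℤ) (x y : Finset (Fin 4) → ℝ) :
    form f (x + y) = form f x + form f y := by
  simp [form, mul_add, Finset.sum_add_distrib]

theorem form_smul (f : List ℤ) (t : ℝ) (x : Finset (Fin 4) → ℝ) :
    form f (t • x) = t * form f x := by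
  simp [form, Finset.mul_sum, mul_left_comm]

theorem rowOf_getD (y : Finset (Fin 4) → ℤ) (k : Fin 16) : (rowOf y).getD k 0 = y (decode k) := by
  simp [rowOf]

theorem form_rowOf (y : Finset (Fin 4) → ℤ) (x : Finset (Fin 4) → ℝ) :
    form (rowOf y) x = ∑ S, x S * (y S : ℝ) := by
  rw [sum_eq_sum_decode]
  exact Finset.sum_congr rfl fun k _ => by rw [rowOf_getD, mul_comm]

theorem rowVec_rowOf (y : Finset (Fin 4) → ℤ) : rowVec (rowOf y) = fun S => (y S : ℝ) := by
  funext S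
  rw [rowVec, rowOf_getD y ⟨code S, code_lt S⟩, decode_code]

/-- The rows of the linear equations satisfied by formal logarithms of bounded ratios. -/
def modularRows : List (List ℤ) :=
  [[1, 1, 1, 1, 1, 1, 1, 1, 1, 1, 1, 1, 1, 1, 1, 1],
   [0, 1, 0, 1, 0, 1, 0, 1, 0, 1, 0, 1, 0, 1, 0, 1],
   [0, 0, 1, 1, 0, 0, 1, 1, 0, 0, 1, 1, 0, 0, 1, 1],
   [0, 0, 0, 0, 1, 1, 1, 1, 0, 0, 0, 0, 1, 1, 1, 1],
   [0, 0, 0, 0, 0, 0, 0, 0, 1, 1, 1, 1, 1, 1, 1, 1]]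

/-- The rows of the facets of the cone of formal logarithms of bounded ratios. -/
def facetRows : List (List ℤ) :=
  [[0, 0, 0, 0, 0, 0, 0, 0, 0, 0, 0, 0, 0, 0, 0, 1],
   [1, 0, 0, 0, 0, 0, 0, 0, 0, 0, 0, 0, 0, 0, 0, 0],
   [2, 1, 1, 0, 1, 0, 0, 0, 1, 0, 0, 0, 0, 0, 0, 0],
   [0, 0, 0, 0, 0, 0, 0, 0, 0, 0, 0, 0, 0, 0, 1, 1],
   [0, 0, 0, 0, 0, 0, 0, 0, 0, 0, 0, 0, 0, 1, 0, 1],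
   [0, 0, 0, 0, 0, 0, 0, 0, 0, 0, 0, 1, 0, 0, 0, 1],
   [0, 0, 0, 0, 0, 0, 0, 1, 0, 0, 0, 0, 0, 0, 0, 1],
   [1, 1, 0, 0, 0, 0, 0, 0, 0, 0, 0, 0, 0, 0, 0, 0],
   [1, 0, 1, 0, 0, 0, 0, 0, 0, 0, 0, 0, 0, 0, 0, 0],
   [1, 0, 0, 0, 1, 0, 0, 0, 0, 0, 0, 0, 0, 0, 0, 0],
   [1, 0, 0, 0, 0, 0, 0, 0, 1, 0, 0, 0, 0, 0, 0, 0],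
   [0, 0, 0, 1, 0, 0, 0, 1, 0, 0, 0, 1, 0, 0, 0, 1],
   [0, 0, 0, 0, 0, 1, 0, 1, 0, 0, 0, 0, 0, 1, 0, 1],
   [0, 0, 0, 0, 0, 0, 0, 0, 0, 1, 0, 1, 0, 1, 0, 1],
   [0, 0, 0, 0, 0, 0, 1, 1, 0, 0, 0, 0, 0, 0, 1, 1],
   [0, 0, 0, 0, 0, 0, 0, 0, 0, 0, 1, 1, 0, 0, 1, 1],
   [0, 0, 0, 0, 0, 0, 0, 0, 0, 0, 0, 0, 1, 1, 1, 1],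
   [2, 1, 1, 1, 1, 0, 0, 0, 1, 0, 0, 0, 0, 0, 0, 0],
   [2, 1, 1, 0, 1, 1, 0, 0, 1, 0, 0, 0, 0, 0, 0, 0],
   [2, 1, 1, 0, 1, 0, 0, 0, 1, 1, 0, 0, 0, 0, 0, 0],
   [2, 1, 1, 0, 1, 0, 1, 0, 1, 0, 0, 0, 0, 0, 0, 0],
   [2, 1, 1, 0, 1, 0, 0, 0, 1, 0, 1, 0, 0, 0, 0, 0],
   [2, 1, 1, 0, 1, 0, 0, 0, 1, 0, 0, 0, 1, 0, 0, 0]]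

/-- The formal logarithms of the generators of the semigroup of bounded ratios. -/
def genRows : List (List ℤ) :=
  [[0, 0, 0, 0, 0, 0, 0, 0, 0, 0, 0, 0, 1, -1, -1, 1],
   [0, 0, 0, 0, 0, 0, 0, 0, 0, 0, 1, -1, 0, 0, -1, 1],
   [0, 0, 0, 0, 0, 0, 0, 0, 0, 1, 0, -1, 0, -1, 0, 1],
   [0, 0, 0, 0, 0, 0, 1, -1, 0, 0, 0, 0, 0, 0, -1, 1],
   [0, 0, 0, 0, 0, 1, 0, -1, 0, 0, 0, 0, 0, -1, 0, 1],
   [0, 0, 0, 1, 0, 0, 0, -1, 0, 0, 0, -1, 0, 0, 0, 1],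
   [1, -1, -1, 1, 0, 0, 0, 0, 0, 0, 0, 0, 0, 0, 0, 0],
   [1, -1, 0, 0, -1, 1, 0, 0, 0, 0, 0, 0, 0, 0, 0, 0],
   [1, -1, 0, 0, 0, 0, 0, 0, -1, 1, 0, 0, 0, 0, 0, 0],
   [1, 0, -1, 0, -1, 0, 1, 0, 0, 0, 0, 0, 0, 0, 0, 0],
   [1, 0, -1, 0, 0, 0, 0, 0, -1, 0, 1, 0, 0, 0, 0, 0],
   [1, 0, 0, 0, -1, 0, 0, 0, -1, 0, 0, 0, 1, 0, 0, 0],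
   [0, 0, 0, 0, 0, 0, 0, 0, 1, -1, -1, 1, 0, 0, 0, 0],
   [0, 0, 0, 0, 0, 0, 0, 0, 1, -1, 0, 0, -1, 1, 0, 0],
   [0, 0, 0, 0, 0, 0, 0, 0, 1, 0, -1, 0, -1, 0, 1, 0],
   [0, 0, 0, 0, 1, -1, -1, 1, 0, 0, 0, 0, 0, 0, 0, 0],
   [0, 0, 0, 0, 1, -1, 0, 0, 0, 0, 0, 0, -1, 1, 0, 0],
   [0, 0, 0, 0, 1, 0, -1, 0, 0, 0, 0, 0, -1, 0, 1, 0],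
   [0, 0, 1, -1, 0, 0, -1, 1, 0, 0, 0, 0, 0, 0, 0, 0],
   [0, 0, 1, -1, 0, 0, 0, 0, 0, 0, -1, 1, 0, 0, 0, 0],
   [0, 0, 1, 0, 0, 0, -1, 0, 0, 0, -1, 0, 0, 0, 1, 0],
   [0, 1, 0, -1, 0, -1, 0, 1, 0, 0, 0, 0, 0, 0, 0, 0],
   [0, 1, 0, -1, 0, 0, 0, 0, 0, -1, 0, 1, 0, 0, 0, 0],
   [0, 1, 0, 0, 0, -1, 0, 0, 0, -1, 0, 0, 0, 1, 0, 0],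
   [0, 0, 0, 1, 1, -1, -1, 0, 1, -1, -1, 0, -1, 1, 1, 0],
   [0, 0, 1, -1, 0, 1, -1, 0, 1, -1, -1, 1, -1, 0, 1, 0],
   [0, 0, 1, -1, 1, -1, -1, 1, 0, 1, -1, 0, -1, 0, 1, 0],
   [0, 1, 0, -1, 0, -1, 1, 0, 1, -1, -1, 1, -1, 1, 0, 0],
   [0, 1, 0, -1, 1, -1, -1, 1, 0, -1, 1, 0, -1, 1, 0, 0],
   [0, 1, 1, -1, 0, -1, -1, 1, 0, -1, -1, 1, 1, 0, 0, 0],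
   [1, -1, -1, 1, -1, 1, 1, -1, 1, 0, 0, -1, 0, -1, -1, 2],
   [1, -1, -1, 1, 1, 0, 0, -1, -1, 1, 1, -1, 0, -1, -1, 2],
   [1, -1, 1, 0, -1, 1, 0, -1, -1, 1, 0, -1, 1, -1, -1, 2],
   [1, 1, -1, 0, -1, 0, 1, -1, -1, 0, 1, -1, 1, -1, -1, 2],
   [2, -1, -1, 0, -1, 0, 0, 1, -1, 1, 1, -1, 1, -1, -1, 1],
   [2, -1, -1, 0, -1, 1, 1, -1, -1, 0, 0, 1, 1, -1, -1, 1],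
   [2, -1, -1, 1, -1, 0, 1, -1, -1, 0, 1, -1, 0, 1, -1, 1],
   [2, -1, -1, 1, -1, 1, 0, -1, -1, 1, 0, -1, 0, -1, 1, 1],
   [1, -1, -1, 1, -1, 1, 1, -1, 2, -1, -1, 0, -1, 0, 0, 1],
   [1, -1, -1, 1, 2, -1, -1, 0, -1, 1, 1, -1, -1, 0, 0, 1],
   [1, -1, 0, 1, 0, 1, -1, -1, 0, 1, -1, -1, -1, -1, 2, 1],
   [1, -1, 2, -1, -1, 1, -1, 0, -1, 1, -1, 0, 1, -1, 0, 1],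
   [1, 0, -1, 1, 0, -1, 1, -1, 0, -1, 1, -1, -1, 2, -1, 1],
   [1, 0, 0, -1, -1, 1, 1, -1, 0, -1, -1, 2, 1, -1, -1, 1],
   [1, 0, 0, -1, 0, -1, -1, 2, -1, 1, 1, -1, 1, -1, -1, 1],
   [1, 2, -1, -1, -1, -1, 1, 0, -1, -1, 1, 0, 1, 0, -1, 1]]

/-- The positions of the facets on which a row is nonzero. -/
def support (v : List ℤ) : List ℕ :=
  (List.range 23).filter fun i => dotRow (facetRows.getD i []) v ≠ 0

/-! ### Decomposition of admissible vectors into generators. -/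

/-- The facet inequalities and equations of the cone of formal logarithms of bounded ratios. -/
structure IsAdmissible (x : Finset (Fin 4) → ℝ) : Prop where
  modular : ∀ f ∈ modularRows, form f x = 0
  nonneg : ∀ f ∈ facetRows, 0 ≤ form f x

/-- The cone generated by the rows in `genRows`. -/
def genCone : AddSubmonoid (Finset (Fin 4) → ℝ) :=
  AddSubmonoid.closure {x | ∃ v ∈ genRows, ∃ t : ℝ, 0 < t ∧ x = t • rowVec v}

theorem map_support_genRows : genRows.map support = supports := by decide +kernel

theorem dotRow_modularRows : ∀ v ∈ genRows, ∀ f ∈ modularRows, dotRow f v = 0 := by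
  decide +kernel

theorem dotRow_facetRows_nonneg : ∀ v ∈ genRows, ∀ f ∈ facetRows, 0 ≤ dotRow f v := by
  decide +kernel

theorem ne_nil_of_mem_supports : ∀ s ∈ supports, s ≠ [] := by decide

/-- The supports form an antichain; this is what makes every generator extreme. -/
theorem eq_of_supports_subset : ∀ a ∈ genRows.zip supports, ∀ b ∈ genRows.zip supports,
    a.2 ⊆ b.2 → a.1 = b.1 := by decide +kernel

theorem mem_zip_supports {v : List ℤ} (hv : v ∈ genRows) :
    (v, support v) ∈ genRows.zip supports := by
  rw [← map_support_genRows, ← List.map_id genRows, List.map_map, List.zip_map']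
  simpa using hv

theorem eq_of_support_subset {v w : List ℤ} (hv : v ∈ genRows) (hw : w ∈ genRows)
    (h : ∀ i < 23, dotRow (facetRows.getD i []) w = 0 → dotRow (facetRows.getD i []) v = 0) :
    v = w := by
  refine eq_of_supports_subset _ (mem_zip_supports hv) _ (mem_zip_supports hw) fun i hi => ?_
  simp only [support, List.mem_filter, List.mem_range, decide_eq_true_eq] at hi ⊢
  exact ⟨hi.1, fun h0 => hi.2 (h i hi.1 h0)⟩

theorem facetRows_getD_mem {i : ℕ} (hi : i < 23) : facetRows.getD i [] ∈ facetRows := by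
  rw [List.getD_eq_getElem (hn := hi)]
  exact List.getElem_mem _

/-- The modular and facet forms together span the dual space, so the admissible cone contains no
line. -/
theorem IsAdmissible.eq_zero {x : Finset (Fin 4) → ℝ} (hx : IsAdmissible x)
    (h : ∀ f ∈ facetRows, form f x = 0) : x = 0 := by
  have hm := hx.modular
  suffices hs : ∀ k : Fin 16, x (decode k) = 0 by
    funext S
    rw [← decode_code S]
    exact hs ⟨code S, code_lt S⟩
  simp only [modularRows, facetRows, List.forall_mem_cons, form, Fin.sum_univ_succ] at hm h
  simp at hm h
  intro k
  fin_cases k <;> dsimp only <;> linarith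

theorem IsAdmissible.exists_support {x : Finset (Fin 4) → ℝ} (hx : IsAdmissible x) (h0 : x ≠ 0) :
    ∃ v ∈ genRows, ∀ i ∈ support v, 0 < form (facetRows.getD i []) x := by
  let z : ℕ → ℝ := fun i => form (facetRows.getD i []) x
  have hz : ∀ i < 23, 0 ≤ z i := fun i hi => hx.nonneg _ (facetRows_getD_mem hi)
  obtain ⟨m, hm⟩ : ∃ X : ℕ → ℝ, ∀ k, x (decode k) = X k := ⟨_, fun _ => rfl⟩
  have hmod := hx.modular
  simp only [modularRows, List.forall_mem_cons, form, Fin.sum_univ_succ] at hmod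
  simp [hm] at hmod
  have he : z 3 + z 4 + z 5 + z 6 = 2 * z 0 + z 2 ∧
      z 7 + z 8 + z 9 + z 10 = 2 * z 1 + z 2 ∧
      z 11 + z 3 + z 4 = z 17 + z 0 ∧
      z 12 + z 3 + z 5 = z 18 + z 0 ∧
      z 13 + z 3 + z 6 = z 19 + z 0 ∧
      z 14 + z 4 + z 5 = z 20 + z 0 ∧
      z 15 + z 4 + z 6 = z 21 + z 0 ∧
      z 16 + z 5 + z 6 = z 22 + z 0 ∧
      z 3 + z 7 = z 14 + z 15 + z 16 ∧
      z 4 + z 8 = z 12 + z 13 + z 16 ∧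
      z 5 + z 9 = z 11 + z 13 + z 15 ∧
      z 6 + z 10 = z 11 + z 12 + z 14 := by
    simp only [z, facetRows, form, Fin.sum_univ_succ]
    simp [hm]
    refine ⟨?_, ?_, ?_, ?_, ?_, ?_, ?_, ?_, ?_, ?_, ?_, ?_⟩ <;> linarith
  obtain ⟨e0, e1, e2, e3, e4, e5, e6, e7, e8, e9, e10, e11⟩ := he
  -- If `z 11`, …, `z 16` vanish, then `e8`–`e11` kill `z 3`, …, `z 10`, next `e0` and `e1` kill `z
  -- 0`, `z 1`, `z 2`, and `e2`–`e7` kill the rest.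
  have hc : 0 < z 11 + z 12 + z 13 + z 14 + z 15 + z 16 := by
    by_contra! hc
    refine h0 (hx.eq_zero fun f hf => ?_)
    obtain ⟨i, hi, rfl⟩ := List.getElem_of_mem hf
    have hi' : i < 23 := hi
    rw [← List.getD_eq_getElem (d := []) (hn := hi)]
    change z i = 0
    have h := List.forall_iff_forall_mem.mpr fun i (hi : i ∈ List.range 23) =>
      hz i (List.mem_range.mp hi)
    simp only [List.range, List.range.loop, List.Forall] at h
    interval_cases i <;> linarith
  obtain ⟨s, hs, hpos⟩ := exists_support_pos hz e0 e1 e2 e3 e4 e5 e6 e7 e8 e9 e10 e11 hc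
  rw [← map_support_genRows] at hs
  obtain ⟨v, hv, rfl⟩ := List.mem_map.mp hs
  exact ⟨v, hv, hpos⟩

theorem IsAdmissible.exists_sub_smul {x : Finset (Fin 4) → ℝ} (hx : IsAdmissible x) (h0 : x ≠ 0) :
    ∃ v ∈ genRows, ∃ t : ℝ, 0 < t ∧ IsAdmissible (x - t • rowVec v) ∧
      ((Finset.range 23).filter fun i => 0 < form (facetRows.getD i []) (x - t • rowVec v)) ⊂
        (Finset.range 23).filter fun i => 0 < form (facetRows.getD i []) x := by
  obtain ⟨v, hv, hpos⟩ := hx.exists_support h0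
  have hV : ∀ i < 23, 0 ≤ (dotRow (facetRows.getD i []) v : ℝ) := fun i hi =>
    Int.cast_nonneg (dotRow_facetRows_nonneg v hv _ (facetRows_getD_mem hi))
  have hform : ∀ f t, form f (x - t • rowVec v) = form f x - t * dotRow f v := fun f t => by
    rw [sub_eq_add_neg, ← neg_smul, form_add, form_smul, form_rowVec]
    ring
  have hsupp : ∀ i, i ∈ support v ↔ i < 23 ∧ dotRow (facetRows.getD i []) v ≠ 0 := fun i => by
    simp [support]
  have hne : (support v).toFinset.Nonempty := by
    rw [List.toFinset_nonempty_iff]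
    exact ne_nil_of_mem_supports _ (map_support_genRows ▸ List.mem_map_of_mem hv)
  -- Ratio test: the least quotient is the largest multiple of `v` that keeps all facet forms
  -- nonnegative, and the form at the minimiser `j` drops to `0`.
  obtain ⟨j, hj, hmin⟩ := Finset.exists_min_image _
    (fun i => form (facetRows.getD i []) x / dotRow (facetRows.getD i []) v) hne
  have hj' := List.mem_toFinset.mp hj
  obtain ⟨hj23, hjV⟩ := (hsupp j).mp hj'
  have hVpos : ∀ i ∈ support v, 0 < (dotRow (facetRows.getD i []) v : ℝ) := fun i hi =>
    lt_of_le_of_ne (hV i ((hsupp i).mp hi).1) (Int.cast_ne_zero.mpr ((hsupp i).mp hi).2).symm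
  have ht := div_pos (hpos j hj') (hVpos j hj')
  refine ⟨v, hv, _, ht, ⟨fun f hf => ?_, fun f hf => ?_⟩, ?_⟩
  · rw [hform, hx.modular f hf, dotRow_modularRows v hv f hf]
    simp
  · obtain ⟨i, hi, rfl⟩ := List.getElem_of_mem hf
    rw [← List.getD_eq_getElem (d := []) (hn := hi), hform, sub_nonneg]
    by_cases his : i ∈ support v
    · exact (le_div_iff₀ (hVpos i his)).mp (hmin i (List.mem_toFinset.mpr his))
    · have h : dotRow (facetRows.getD i []) v = 0 := by
        by_contra h
        exact his ((hsupp i).mpr ⟨hi, h⟩)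
      rw [h, Int.cast_zero, mul_zero]
      exact hx.nonneg _ (facetRows_getD_mem hi)
  · refine Finset.ssubset_iff_subset_ne.mpr ⟨fun i hi => ?_, fun h => ?_⟩
    · simp only [Finset.mem_filter, Finset.mem_range, hform] at hi ⊢
      exact ⟨hi.1, by linarith [hi.2, mul_nonneg ht.le (hV i hi.1)]⟩
    · have h1 : j ∈ (Finset.range 23).filter fun i => 0 < form (facetRows.getD i []) x := by
        simpa using ⟨hj23, hpos j hj'⟩
      rw [← h] at h1
      simp only [Finset.mem_filter, hform, div_mul_cancel₀ _ (hVpos j hj').ne', sub_self,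
        lt_irrefl, and_false] at h1

/-- Induction on the set of facet forms that are positive on `x`, which shrinks strictly with every
subtraction. -/
theorem IsAdmissible.mem_genCone {x : Finset (Fin 4) → ℝ} (hx : IsAdmissible x) : x ∈ genCone := by
  induction h : (Finset.range 23).filter fun i => 0 < form (facetRows.getD i []) x
    using Finset.strongInduction generalizing x with
  | H s ih =>
    subst h
    by_cases h0 : x = 0
    · rw [h0]
      exact genCone.zero_mem
    · obtain ⟨v, hv, t, ht, hadm, hlt⟩ := hx.exists_sub_smul h0
      rw [← sub_add_cancel x (t • rowVec v)]
      exact genCone.add_mem (ih _ hlt hadm rfl)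
        (AddSubmonoid.subset_closure ⟨v, hv, t, ht, rfl⟩)

/-! ### Formal logarithms of the named ratios as integer rows. -/

section Table

theorem log_ofSets {l m : List (Finset (Fin 4))} {v : List ℤ}
    (h0 : ∑ k : Fin 16, v.getD k 0 = 0)
    (h : ∀ S, S ≠ ∅ → (l.count S : ℤ) - m.count S = v.getD (code S) 0) :
    (Ratio.ofSets l m).log = rowVec v := by
  have hcount : ∀ (l : List (Finset (Fin 4))) S,
      (Collection.ofSets l).exponent S = ((l.count S : ℤ) : ℝ) := fun l S => by
    induction l with
    | nil => simp [Collection.ofSets, Collection.exponent]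
    | cons T l ih =>
      have h1 : (Collection.ofSets (T :: l)).exponent S =
          (if T = S then 1 else 0) + (Collection.ofSets l).exponent S :=
        Collection.exponent_cons _ _ _
      rw [h1, ih, List.count_cons]
      by_cases hTS : T = S <;> simp [hTS, add_comm]
  refine Ratio.log_ext ?_ fun S hS => ?_
  · rw [sum_eq_sum_decode]
    simp only [rowVec, code_decode]
    exact_mod_cast h0
  · simp only [rowVec, ← h S hS]
    push_cast
    exact congrArg₂ _ (hcount l S) (hcount m S)

/-- The row of the permutation by `σ` of the vector with row `v`. -/
def permRow (σ : Equiv.Perm (Fin 4)) (v : List ℤ) : List ℤ :=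
  rowOf fun S => v.getD (code (S.map σ.symm.toEmbedding)) 0

/-- The row of the complement of the vector with row `v`. -/
def complRow (v : List ℤ) : List ℤ := rowOf fun S => v.getD (code Sᶜ) 0

theorem permute_rowVec (σ : Equiv.Perm (Fin 4)) (v : List ℤ) :
    permute σ (rowVec v) = rowVec (permRow σ v) := by
  rw [permRow, rowVec_rowOf]
  rfl

theorem complement_rowVec (v : List ℤ) : complement (rowVec v) = rowVec (complRow v) := by
  rw [complRow, rowVec_rowOf]
  rfl

theorem permutations_eq {r : Ratio 4} {v : List ℤ} (h : r.log = rowVec v) :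
    permutations r = rowVec '' {w | w ∈ Set.range fun σ => permRow σ v} := by
  ext x
  simp [permutations, h, permute_rowVec]

theorem orbit_eq {r : Ratio 4} {v : List ℤ} (h : r.log = rowVec v) :
    orbit r = rowVec '' {w | w ∈ (Set.range fun σ => permRow σ v) ∪
      Set.range fun σ => complRow (permRow σ v)} := by
  ext x
  simp [orbit, permutations, h, permute_rowVec, complement_rowVec, or_and_right, exists_or]

/-- The row of the formal logarithm of a ratio of products of sets. -/
def ratioRow (l m : List (Finset (Fin 4))) : List ℤ :=
  rowOf fun S => if S = ∅ then (m.countP (· ≠ ∅) : ℤ) - l.countP (· ≠ ∅)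
    else (l.count S : ℤ) - m.count S

theorem log_koteljanskii : ∀ S T : Finset (Fin 4), (koteljanskii S T).log =
    rowVec (ratioRow [S ∪ T, S ∩ T] [S, T]) := by
  intro S T
  refine log_ofSets (by revert S T; decide +kernel) fun U hU => ?_
  rw [ratioRow, rowOf_getD _ ⟨code U, code_lt U⟩, decode_code, if_neg hU]

theorem log_K₁ : K₁.log = rowVec (genRows.getD 6 []) :=
  log_ofSets (by decide +kernel) (by decide +kernel)

theorem log_K₂ : K₂.log = rowVec (genRows.getD 21 []) :=
  log_ofSets (by decide +kernel) (by decide +kernel)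

theorem log_R₁ : R₁.log = rowVec (genRows.getD 27 []) :=
  log_ofSets (by decide +kernel) (by decide +kernel)

theorem log_R₂ : R₂.log = rowVec (genRows.getD 33 []) :=
  log_ofSets (by decide +kernel) (by decide +kernel)

theorem log_R₃ : R₃.log = rowVec (genRows.getD 45 []) :=
  log_ofSets (by decide +kernel) (by decide +kernel)

end Table

/-! ### The generators as orbits under permutation and complementation. -/

section Orbits

theorem permRow_R₁_mem : ∀ σ, permRow σ (genRows.getD 27 []) ∈ (genRows.drop 24).take 6 := by
  decide +kernel

theorem exists_permRow_R₁ : ∀ v ∈ (genRows.drop 24).take 6,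
    ∃ σ, permRow σ (genRows.getD 27 []) = v := by
  decide +kernel

theorem permRow_R₂_mem : ∀ σ, permRow σ (genRows.getD 33 []) ∈ genRows.drop 30 ∧
    complRow (permRow σ (genRows.getD 33 [])) ∈ genRows.drop 30 := by
  decide +kernel

theorem permRow_R₃_mem : ∀ σ, permRow σ (genRows.getD 45 []) ∈ genRows.drop 30 ∧
    complRow (permRow σ (genRows.getD 45 [])) ∈ genRows.drop 30 := by
  decide +kernel

theorem exists_permRow_R₂_or_R₃ : ∀ v ∈ genRows.drop 30,
    ∃ σ, (permRow σ (genRows.getD 33 []) = v ∨ complRow (permRow σ (genRows.getD 33 [])) = v) ∨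
      permRow σ (genRows.getD 45 []) = v ∨ complRow (permRow σ (genRows.getD 45 [])) = v := by
  decide +kernel

/-- Complements are needed only for `K₁`, since the complement of `K₂` is again a permutation of
`K₂`. -/
theorem exists_permRow_K₁_or_K₂ : ∀ v ∈ genRows.take 24,
    ∃ σ, (permRow σ (genRows.getD 6 []) = v ∨ complRow (permRow σ (genRows.getD 6 [])) = v) ∨
      permRow σ (genRows.getD 21 []) = v := by
  decide +kernel

theorem ratioRow_koteljanskii_mem : ∀ S T : Finset (Fin 4), S.card = T.card →
    T.card = (S ∩ T).card + 1 → ratioRow [S ∪ T, S ∩ T] [S, T] ∈ genRows.take 24 := by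
  decide +kernel

theorem exists_ratioRow_koteljanskii : ∀ v ∈ genRows.take 24, ∃ S T : Finset (Fin 4),
    (S.card = T.card ∧ T.card = (S ∩ T).card + 1) ∧ ratioRow [S ∪ T, S ∩ T] [S, T] = v := by
  decide +kernel

theorem basicKoteljanskii_eq : basicKoteljanskii 4 = rowVec '' {v | v ∈ genRows.take 24} := by
  ext x
  constructor
  · rintro ⟨S, T, h1, h2, rfl⟩
    exact ⟨_, ratioRow_koteljanskii_mem S T h1 h2, (log_koteljanskii S T).symm⟩
  · rintro ⟨v, hv, rfl⟩
    obtain ⟨S, T, ⟨h1, h2⟩, rfl⟩ := exists_ratioRow_koteljanskii v hv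
    exact ⟨S, T, h1, h2, (log_koteljanskii S T).symm⟩

theorem permutations_R₁_eq :
    permutations R₁ = rowVec '' {v | v ∈ (genRows.drop 24).take 6} := by
  rw [permutations_eq log_R₁]
  congr 1
  ext v
  exact ⟨fun ⟨σ, h⟩ => h ▸ permRow_R₁_mem σ, exists_permRow_R₁ v⟩

theorem orbit_R₂_union_orbit_R₃_eq :
    orbit R₂ ∪ orbit R₃ = rowVec '' {v | v ∈ genRows.drop 30} := by
  rw [orbit_eq log_R₂, orbit_eq log_R₃, ← Set.image_union]
  congr 1
  ext v
  constructor
  · rintro ((⟨σ, rfl⟩ | ⟨σ, rfl⟩) | (⟨σ, rfl⟩ | ⟨σ, rfl⟩))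
    · exact (permRow_R₂_mem σ).1
    · exact (permRow_R₂_mem σ).2
    · exact (permRow_R₃_mem σ).1
    · exact (permRow_R₃_mem σ).2
  · intro hv
    obtain ⟨σ, (h | h) | (h | h)⟩ := exists_permRow_R₂_or_R₃ v hv
    exacts [.inl (.inl ⟨σ, h⟩), .inl (.inr ⟨σ, h⟩), .inr (.inl ⟨σ, h⟩), .inr (.inr ⟨σ, h⟩)]

theorem mem_genRows_iff {v : List ℤ} : v ∈ genRows ↔
    (v ∈ genRows.take 24 ∨ v ∈ (genRows.drop 24).take 6) ∨ v ∈ genRows.drop 30 := by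
  have h : genRows = genRows.take 24 ++ (genRows.drop 24).take 6 ++ genRows.drop 30 := rfl
  conv_lhs => rw [h]
  simp only [List.mem_append]

theorem exists_rowVec_mem_orbit {v : List ℤ} (hv : v ∈ genRows) :
    ∃ g ∈ ({K₁, K₂, R₁, R₂, R₃} : Set (Ratio 4)), rowVec v ∈ orbit g := by
  rcases mem_genRows_iff.mp hv with (hv | hv) | hv
  · obtain ⟨σ, (h | h) | h⟩ := exists_permRow_K₁_or_K₂ v hv
    · exact ⟨K₁, by simp, orbit_eq log_K₁ ▸ ⟨v, .inl ⟨σ, h⟩, rfl⟩⟩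
    · exact ⟨K₁, by simp, orbit_eq log_K₁ ▸ ⟨v, .inr ⟨σ, h⟩, rfl⟩⟩
    · exact ⟨K₂, by simp, orbit_eq log_K₂ ▸ ⟨v, .inl ⟨σ, h⟩, rfl⟩⟩
  · exact ⟨R₁, by simp, .inl (permutations_R₁_eq ▸ ⟨v, hv, rfl⟩)⟩
  · have h : rowVec v ∈ orbit R₂ ∪ orbit R₃ := orbit_R₂_union_orbit_R₃_eq ▸ ⟨v, hv, rfl⟩
    rcases h with h | h
    · exact ⟨R₂, by simp, h⟩
    · exact ⟨R₃, by simp, h⟩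

end Orbits

/-! ### The cone of bounded ratios equals the cone of the generators. -/

section Cone

/-- The Gram determinant on `S` of the vectors `(p i, q i)`. -/
def gramDet (p q : Fin 4 → ℤ) (S : Finset (Fin 4)) : ℤ :=
  (∑ i ∈ S, p i ^ 2) * (∑ i ∈ S, q i ^ 2) - (∑ i ∈ S, p i * q i) ^ 2

/-- Two minus the rank on `S` of a configuration of nonzero plane vectors `(p i, q i)`. -/
def corank (p q : Fin 4 → ℤ) (S : Finset (Fin 4)) : ℕ :=
  if S = ∅ then 2 else if gramDet p q S = 0 then 1 else 0

/-- Configurations of four nonzero plane vectors, at most two of which are parallel. -/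
def planeConfigs : List ((Fin 4 → ℤ) × (Fin 4 → ℤ)) :=
  [(![1, 0, 1, 1], ![0, 1, 1, -1]), (![1, 1, 0, 1], ![0, 0, 1, 1]), (![1, 0, 1, 1], ![0, 1, 0, 1]),
   (![1, 0, 1, 1], ![0, 1, 1, 0]), (![0, 1, 1, 1], ![1, 0, 0, 1]), (![0, 1, 1, 1], ![1, 0, 1, 0]),
   (![0, 1, 1, 1], ![1, 1, 0, 0])]

theorem corank_spec : ∀ c ∈ planeConfigs, ∀ S,
    (corank c.1 c.2 S = 0 ∧ 0 < gramDet c.1 c.2 S) ∨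
      (corank c.1 c.2 S = 1 ∧ gramDet c.1 c.2 S = 0 ∧
        0 < ∑ i ∈ S, c.1 i ^ 2 + ∑ i ∈ S, c.2 i ^ 2) ∨ (corank c.1 c.2 S = 2 ∧ S = ∅) := by
  decide +kernel

/-- Rows 0, 3–6 and 11–16 come from supersets of `B`, rows 1 and 7–10 from sets disjoint from `B`,
row 2 from four plane vectors in general position, and rows 17–22 from those with one parallel pair.
-/
theorem facetRows_eq : ∀ f ∈ facetRows,
    (∃ B, f = rowOf fun S => if S ∩ B = ∅ then 1 else 0) ∨
      (∃ B, f = rowOf fun S => if B ⊆ S then 1 else 0) ∨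
        ∃ c ∈ planeConfigs, f = rowOf fun S => corank c.1 c.2 S := by
  decide +kernel

theorem modularRows_eq : ∀ f ∈ modularRows,
    f = rowOf (fun _ => 1) ∨ ∃ i, f = rowOf fun S => if i ∈ S then 1 else 0 := by
  decide +kernel

theorem BoundedForm.isAdmissible {𝕜 : Type*} [RCLike 𝕜] {x : Finset (Fin 4) → ℝ}
    (hx : BoundedForm 𝕜 x) (h0 : ∑ S, x S = 0) : IsAdmissible x where
  modular f hf := by
    obtain rfl | ⟨i, rfl⟩ := modularRows_eq f hf
    · simpa [form_rowOf] using h0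
    · simpa [form_rowOf] using hx.sum_mem_eq_zero i
  nonneg f hf := by
    obtain ⟨B, rfl⟩ | ⟨B, rfl⟩ | ⟨c, hc, rfl⟩ := facetRows_eq f hf
    · simpa [form_rowOf] using hx.sum_disjoint_nonneg h0 B
    · simpa [form_rowOf] using hx.sum_superset_nonneg h0 B
    · simpa [form_rowOf] using hx.sum_corank_nonneg h0 c.1 c.2 _ (corank_spec c hc)

theorem boundedForm_rowVec (𝕜 : Type*) [RCLike 𝕜] {v : List ℤ} (hv : v ∈ genRows) :
    BoundedForm 𝕜 (rowVec v) := by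
  obtain ⟨g, hg, h⟩ := exists_rowVec_mem_orbit hv
  rcases hg with rfl | rfl | rfl | rfl | rfl
  exacts [boundedForm_K₁.of_mem_orbit h, boundedForm_K₂.of_mem_orbit h,
    boundedForm_R₁.of_mem_orbit h, boundedForm_R₂.of_mem_orbit h, boundedForm_R₃.of_mem_orbit h]

theorem sum_rowVec {v : List ℤ} (hv : v ∈ genRows) : ∑ S, rowVec v S = 0 := by
  obtain ⟨g, -, h⟩ := exists_rowVec_mem_orbit hv
  exact sum_of_mem_orbit h

theorem logBoundedRatios_eq_genCone (𝕜 : Type*) [RCLike 𝕜] :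
    logBoundedRatios 𝕜 4 = (genCone : Set (Finset (Fin 4) → ℝ)) := by
  rw [logBoundedRatios_eq]
  refine Set.Subset.antisymm (fun x hx => (hx.2.isAdmissible hx.1).mem_genCone) fun x hx => ?_
  refine AddSubmonoid.closure_induction ?_ ?_ ?_ hx
  · rintro _ ⟨v, hv, t, ht, rfl⟩
    refine ⟨?_, (boundedForm_rowVec 𝕜 hv).smul ht.le⟩
    simp [← Finset.mul_sum, sum_rowVec hv]
  · exact ⟨by simp, BoundedForm.zero⟩
  · rintro x y - - ⟨hx0, hx⟩ ⟨hy0, hy⟩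
    exact ⟨by simp [Finset.sum_add_distrib, hx0, hy0], hx.add hy⟩

theorem Ratio.isBounded_iff_log_mem (𝕜 : Type*) [RCLike 𝕜] {r : Ratio 4} :
    r.IsBounded 𝕜 ↔ r.log ∈ genCone := by
  rw [← SetLike.mem_coe, ← logBoundedRatios_eq_genCone 𝕜, logBoundedRatios_eq, r.isBounded_iff]
  exact ⟨fun h => ⟨r.sum_log, h⟩, And.right⟩

theorem exists_mem_closure_log_eq {x : Finset (Fin 4) → ℝ} (hx : x ∈ genCone) :
    ∃ s ∈ Submonoid.closure {q : Ratio 4 | ∃ g ∈ ({K₁, K₂, R₁, R₂, R₃} : Set (Ratio 4)),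
      ∃ h : Ratio 4, h.log ∈ orbit g ∧ ∃ t, q = h.rpow t}, s.log = x := by
  refine AddSubmonoid.closure_induction ?_ ?_ ?_ hx
  · rintro _ ⟨v, hv, t, ht, rfl⟩
    obtain ⟨g, hg, h⟩ := exists_rowVec_mem_orbit hv
    obtain ⟨r, hr⟩ := Ratio.exists_log_eq (sum_rowVec hv)
    exact ⟨r.rpow ⟨t, ht⟩, Submonoid.subset_closure ⟨g, hg, r, hr ▸ h, _, rfl⟩,
      (r.log_rpow _).trans (by rw [hr])⟩
  · exact ⟨1, one_mem _, Ratio.log_one⟩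
  · rintro _ _ - - ⟨r, hr, rfl⟩ ⟨s, hs, rfl⟩
    exact ⟨r * s, mul_mem hr hs, Ratio.log_mul r s⟩

theorem boundedRatios_eq_generatedUpToSymmetry (𝕜 : Type*) [RCLike 𝕜] :
    (boundedRatios 𝕜 4 : Set (Ratio 4)) = generatedUpToSymmetry {K₁, K₂, R₁, R₂, R₃} := by
  ext r
  constructor
  · intro hr
    obtain ⟨s, hs, h⟩ := exists_mem_closure_log_eq ((Ratio.isBounded_iff_log_mem 𝕜).mp hr)
    exact ⟨s, hs, h.symm⟩
  · rintro ⟨s, hs, h⟩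
    refine r.isBounded_iff.mpr ((h : r.log = s.log) ▸ ?_)
    refine Submonoid.closure_induction (motive := fun s _ => BoundedForm 𝕜 s.log) ?_ ?_ ?_ hs
    · rintro _ ⟨g, hg, q, hq, t, rfl⟩
      rw [Ratio.log_rpow]
      refine BoundedForm.smul ?_ t.2.le
      rcases hg with rfl | rfl | rfl | rfl | rfl
      exacts [boundedForm_K₁.of_mem_orbit hq, boundedForm_K₂.of_mem_orbit hq,
        boundedForm_R₁.of_mem_orbit hq, boundedForm_R₂.of_mem_orbit hq,
        boundedForm_R₃.of_mem_orbit hq]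
    · rw [Ratio.log_one]
      exact BoundedForm.zero
    · intro r s _ _ hr hs
      rw [Ratio.log_mul]
      exact hr.add hs

end Cone

/-! ### Extreme rays of the generated cone and their number. -/

section ExtremeRays

theorem ray_smul {E : Type*} [AddCommGroup E] [Module ℝ E] {s : ℝ} (hs : 0 < s) (v : E) :
    ray (s • v) = ray v := by
  ext w
  constructor
  · rintro ⟨t, ht, rfl⟩
    exact ⟨t * s, by positivity, smul_smul t s v⟩
  · rintro ⟨t, ht, rfl⟩
    exact ⟨t / s, by positivity, by rw [smul_smul, div_mul_cancel₀ t hs.ne']⟩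

theorem mem_ray_self {E : Type*} [AddCommGroup E] [Module ℝ E] (v : E) : v ∈ ray v :=
  ⟨1, zero_le_one, (one_smul ℝ v).symm⟩

theorem rowVec_ne_zero {v : List ℤ} (hv : v ∈ genRows) : rowVec v ≠ 0 := by
  have h : ∀ v ∈ genRows, ∃ f ∈ facetRows, dotRow f v ≠ 0 := by decide +kernel
  obtain ⟨f, -, hf⟩ := h v hv
  intro h0
  have h1 := form_rowVec f v
  rw [h0] at h1
  refine hf (Int.cast_eq_zero.mp (h1.symm.trans ?_))
  simp [form]

theorem nonneg_of_mem_genCone {x : Finset (Fin 4) → ℝ} (hx : x ∈ genCone) {f : List ℤ}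
    (hf : f ∈ facetRows) : 0 ≤ form f x := by
  refine AddSubmonoid.closure_induction ?_ ?_ ?_ hx
  · rintro _ ⟨v, hv, t, ht, rfl⟩
    rw [form_smul, form_rowVec]
    exact mul_nonneg ht.le (Int.cast_nonneg (dotRow_facetRows_nonneg v hv f hf))
  · simp [form]
  · intro x y _ _ hx hy
    rw [form_add]
    exact add_nonneg hx hy

theorem smul_mem_genCone {x : Finset (Fin 4) → ℝ} (hx : x ∈ genCone) {s : ℝ} (hs : 0 < s) :
    s • x ∈ genCone := by
  refine AddSubmonoid.closure_induction ?_ ?_ ?_ hx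
  · rintro _ ⟨v, hv, t, ht, rfl⟩
    exact AddSubmonoid.subset_closure ⟨v, hv, s * t, mul_pos hs ht, smul_smul s t _⟩
  · rw [smul_zero]
    exact zero_mem _
  · intro x y _ _ hx hy
    rw [smul_add]
    exact add_mem hx hy

theorem rowVec_mem_genCone {v : List ℤ} (hv : v ∈ genRows) : rowVec v ∈ genCone :=
  AddSubmonoid.subset_closure ⟨v, hv, 1, one_pos, (one_smul ℝ _).symm⟩

/-- Facet forms are nonnegative on the cone, so one that vanishes on a sum vanishes on each summand.
A generator occurring in `x` thus has its support inside that of `v` and equals `v` by the antichain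
property. -/
theorem mem_ray_of_form_eq_zero {x : Finset (Fin 4) → ℝ} (hx : x ∈ genCone) {v : List ℤ}
    (hv : v ∈ genRows) (h : ∀ i < 23, dotRow (facetRows.getD i []) v = 0 →
      form (facetRows.getD i []) x = 0) : x ∈ ray (rowVec v) := by
  revert h
  refine AddSubmonoid.closure_induction ?_ ?_ ?_ hx
  · rintro _ ⟨w, hw, t, ht, rfl⟩ h
    have hwv : w = v := eq_of_support_subset hw hv fun i hi h0 => by
      have h1 := h i hi h0
      rw [form_smul, form_rowVec] at h1
      exact Int.cast_eq_zero.mp ((mul_eq_zero.mp h1).resolve_left ht.ne')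
    exact ⟨t, ht.le, by rw [hwv]⟩
  · exact fun _ => ⟨0, le_rfl, (zero_smul ℝ _).symm⟩
  · intro x y hx hy ihx ihy h
    have h1 : ∀ i < 23, dotRow (facetRows.getD i []) v = 0 →
        form (facetRows.getD i []) x = 0 ∧ form (facetRows.getD i []) y = 0 :=
      fun i hi h0 => (add_eq_zero_iff_of_nonneg (nonneg_of_mem_genCone hx (facetRows_getD_mem hi))
        (nonneg_of_mem_genCone hy (facetRows_getD_mem hi))).mp (form_add _ x y ▸ h i hi h0)
    obtain ⟨s, hs, rfl⟩ := ihx fun i hi h0 => (h1 i hi h0).1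
    obtain ⟨t, ht, rfl⟩ := ihy fun i hi h0 => (h1 i hi h0).2
    exact ⟨s + t, add_nonneg hs ht, (add_smul s t _).symm⟩

/-- The ray is the face cut out by the facet forms that vanish on `v`. -/
theorem isExtreme_ray_rowVec {v : List ℤ} (hv : v ∈ genRows) :
    IsExtreme ℝ (genCone : Set (Finset (Fin 4) → ℝ)) (ray (rowVec v)) where
  subset := by
    rintro _ ⟨t, ht, rfl⟩
    rcases ht.eq_or_lt with rfl | ht
    · rw [zero_smul]
      exact zero_mem genCone
    · exact smul_mem_genCone (rowVec_mem_genCone hv) ht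
  left_mem_of_mem_openSegment := by
    rintro x hx y hy _ ⟨t, ht, rfl⟩ ⟨a, b, ha, hb, -, hxy⟩
    refine mem_ray_of_form_eq_zero hx hv fun i hi h0 => ?_
    have h1 := congrArg (form (facetRows.getD i [])) hxy
    rw [form_add, form_smul, form_smul, form_smul, form_rowVec, h0, Int.cast_zero, mul_zero] at h1
    have h2 := nonneg_of_mem_genCone hx (facetRows_getD_mem hi)
    have h3 := nonneg_of_mem_genCone hy (facetRows_getD_mem hi)
    exact (mul_eq_zero.mp ((add_eq_zero_iff_of_nonneg (mul_nonneg ha.le h2)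
      (mul_nonneg hb.le h3)).mp h1).1).resolve_left ha.ne'

theorem exists_eq_smul_add {x : Finset (Fin 4) → ℝ} (hx : x ∈ genCone) (h0 : x ≠ 0) :
    ∃ v ∈ genRows, ∃ t : ℝ, 0 < t ∧ ∃ y ∈ genCone, x = t • rowVec v + y := by
  revert h0
  refine AddSubmonoid.closure_induction ?_ ?_ ?_ hx
  · rintro _ ⟨v, hv, t, ht, rfl⟩ -
    exact ⟨v, hv, t, ht, 0, zero_mem _, (add_zero _).symm⟩
  · exact fun h => absurd rfl h
  · intro x y _ hy ihx ihy h0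
    by_cases hx0 : x = 0
    · rw [hx0, zero_add] at h0 ⊢
      exact ihy h0
    · obtain ⟨v, hv, t, ht, z, hz, rfl⟩ := ihx hx0
      exact ⟨v, hv, t, ht, z + y, add_mem hz hy, add_assoc _ _ _⟩

theorem extremeRays_genCone : extremeRays (genCone : Set (Finset (Fin 4) → ℝ)) =
    ray '' (rowVec '' {v | v ∈ genRows}) := by
  ext ρ
  constructor
  · rintro ⟨⟨u, hu, rfl⟩, hρ⟩
    obtain ⟨v, hv, t, ht, y, hy, huy⟩ := exists_eq_smul_add (hρ.subset (mem_ray_self u)) hu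
    -- Since `u = t • rowVec v + y` is the midpoint of `(2 * t) • rowVec v` and `2 • y`, extremality
    -- puts the first endpoint on the ray of `u`.
    have h1 : (2 * t) • rowVec v ∈ ray u :=
      hρ.left_mem_of_mem_openSegment (smul_mem_genCone (rowVec_mem_genCone hv) (by positivity))
        (smul_mem_genCone hy two_pos) (mem_ray_self u)
        ⟨1 / 2, 1 / 2, by norm_num, by norm_num, by norm_num, by
          rw [smul_smul, smul_smul, huy, ← mul_assoc]
          norm_num⟩
    obtain ⟨s, hs, h2⟩ := h1
    have hs : 0 < s := hs.lt_of_ne' fun h => by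
      rw [h, zero_smul, smul_eq_zero] at h2
      exact h2.elim (by positivity) (rowVec_ne_zero hv)
    exact ⟨_, ⟨v, hv, rfl⟩, by rw [← ray_smul (by positivity : 0 < 2 * t), h2, ray_smul hs]⟩
  · rintro ⟨_, ⟨v, hv, rfl⟩, rfl⟩
    exact ⟨⟨_, rowVec_ne_zero hv, rfl⟩, isExtreme_ray_rowVec hv⟩

theorem injOn_ray_rowVec : Set.InjOn (fun v => ray (rowVec v)) {v | v ∈ genRows} := by
  intro v hv w hw h
  obtain ⟨t, -, ht⟩ := (congrArg (rowVec v ∈ ·) h).mp (mem_ray_self _)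
  refine eq_of_support_subset hv hw fun i _ h0 => ?_
  have h1 := congrArg (form (facetRows.getD i [])) ht
  rw [form_smul, form_rowVec, form_rowVec, h0, Int.cast_zero, mul_zero] at h1
  exact Int.cast_eq_zero.mp h1

theorem ncard_ray_rowVec {l : List (List ℤ)} (hl : l.Sublist genRows) :
    (ray '' (rowVec '' {v | v ∈ l})).ncard = l.length := by
  have h : genRows.Nodup := by decide +kernel
  have hl' : {v | v ∈ l} ⊆ {v | v ∈ genRows} := fun v hv => hl.subset hv
  rw [Set.image_image, (injOn_ray_rowVec.mono hl').ncard_image,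
    ← List.toFinset_card_of_nodup (h.sublist hl), ← Set.ncard_coe_finset, List.coe_toFinset]

end ExtremeRays

end PDRatio

theorem mainTheorem3 (𝕜 : Type*) [RCLike 𝕜] :
    (PDRatio.boundedRatios 𝕜 4 : Set (PDRatio.Ratio 4)) =
      PDRatio.generatedUpToSymmetry
        {PDRatio.K₁, PDRatio.K₂, PDRatio.R₁, PDRatio.R₂, PDRatio.R₃} ∧
    PDRatio.extremeRays (PDRatio.logBoundedRatios 𝕜 4) =
      PDRatio.ray '' PDRatio.basicKoteljanskii 4 ∪
      PDRatio.ray '' PDRatio.permutations PDRatio.R₁ ∪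
      PDRatio.ray '' (PDRatio.orbit PDRatio.R₂ ∪ PDRatio.orbit PDRatio.R₃) ∧
    (PDRatio.extremeRays (PDRatio.logBoundedRatios 𝕜 4)).ncard = 46 ∧
    (PDRatio.ray '' PDRatio.basicKoteljanskii 4).ncard = 24 ∧
    (PDRatio.ray '' PDRatio.permutations PDRatio.R₁).ncard = 6 ∧
    (PDRatio.ray '' (PDRatio.orbit PDRatio.R₂ ∪ PDRatio.orbit PDRatio.R₃)).ncard = 16 := by
  rw [PDRatio.logBoundedRatios_eq_genCone, PDRatio.extremeRays_genCone,
    PDRatio.basicKoteljanskii_eq, PDRatio.permutations_R₁_eq, PDRatio.orbit_R₂_union_orbit_R₃_eq]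
  refine ⟨PDRatio.boundedRatios_eq_generatedUpToSymmetry 𝕜, ?_,
    PDRatio.ncard_ray_rowVec (List.Sublist.refl _),
    PDRatio.ncard_ray_rowVec (List.take_sublist _ _),
    PDRatio.ncard_ray_rowVec ((List.take_sublist _ _).trans (List.drop_sublist _ _)),
    PDRatio.ncard_ray_rowVec (List.drop_sublist _ _)⟩
  -- With the images pulled out of the unions, only the splitting of `genRows` into segments of
  -- lengths 24, 6 and 16 remains.
  rw [← Set.image_union, ← Set.image_union, ← Set.image_union, ← Set.image_union]
  congr 2
  ext v
  exact PDRatio.mem_genRows_iff
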